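/- **Setting.** Let $\mathcal Z$ be a compact metric space and $\mu$ a Borel probability measure on it with full support. Let $z_1,z_2,\dots$ be i.i.d. with law $\mu$; let $\psi_1,\psi_2,\dots$ be (jointly measurable) real random functions on $\mathcal Z$; let $\mathbf e_1,\mathbf e_2,\dots$ be i.i.d. noise vectors with independent, zero-mean, unit-variance entries $\mathbf E_{ij}$; and let $\epsilon_1,\epsilon_2,\dots$ be i.i.d. with mean zero and variance $\sigma_y^2\ge 0$. The four sources $(z_i)$, $(\psi_j)$, $(\mathbf E_{ij})$, $(\epsilon_i)$ are mutually independent. Assume that each $\psi_j$ is pointwise square integrable and mean-square continuous, that $\sup_{j,z}\mathbb E|\psi_j(z)|^4<\infty$ and $\sup_{i,j}\mathbb E|\mathbf E_{ij}|^4<\infty$, and that the $\psi_j$ are mutually independent. For $\sigma_x\ge0$ the $n\times p$ data matrix $\mathbf X$ has entries $\psi_j(z_i)+\sigma_x\mathbf E_{ij}$. For each $p\ge1$ let $\lambda_1\ge\dots\ge\lambda_{k_{\max}}>0$ be all the non-zero eigenvalues, counted with multiplicity, of the integral operator on $L^2(\mu)$ with kernel $\frac1p\sum_{j\le p}\mathbb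 E[\psi_j(z)\psi_j(z')]$, assumed finite in number, with orthonormal eigenfunctions $u_1,\dots,u_{k_{\max}}$ (all depending on $p$). Put $\phi(z)=(\lambda_k^{1/2}u_k(z))_{k\le k_{\max}}$ and $\boldsymbol\Lambda=\mathrm{diag}(\lambda_k)$, and suppose $g(z)=\langle\phi(z),\theta^*\rangle$ for all $z$, with $\theta^*\in\mathbb R^{k_{\max}}$ ($g$ may depend on $p$). Responses are $y_i=g(z_i)+\epsilon_i$. For $0\le k<k_{\max}$ let $$\beta_k=\sup_{z}\max\Big\{\frac{\sum_{l\le k}u_l(z)^2}{k},\ \frac{\sum_{l>k}\lambda_lu_l(z)^2}{\sum_{l>k}\lambda_l},\ \frac{\sum_{l>k}\lambda_l^2u_l(z)^2}{\sum_{l>k}\lambda_l^2}\Big\}$$ (the first term being absent for $k=0$), and let $$v_1=\sup_{z,z'}\frac1p\sum_{j\le p}\mathrm{Var}[\psi_j(z)\psi_j(z')],\quad v_2=\sup_z\frac1p\sum_{j\le p}\mathbb E|\psi_j(z)|^2,\quad v_3=\sup_{i,j}\mathbb E|\mathbf E_{ij}|^4 .$$ Let $\boldsymbol\Phi$ be the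 $n\times k_{\max}$ matrix with rows $\phi(z_i)$, let $\mathbf E=(\mathbf E_{ij})_{i\le n,\,j\le p}$, $\mathbf W_{jk}=(\lambda_kp)^{-1/2}\int\psi_ju_k\,d\mu$, $\mathbf A=p^{-1}\mathbf X\mathbf X^\top+n\gamma\mathbf I_n$ and $\hat\theta(\tilde{\mathbf y})=\boldsymbol\Phi^\top\mathbf A^{-1}\tilde{\mathbf y}$. Write $\|v\|_{\mathbf D}^2=v^\top\mathbf Dv$, $\boldsymbol\epsilon=(\epsilon_1,\dots,\epsilon_n)^\top$ and $\mathbf y=(y_1,\dots,y_n)^\top$. With $z_{test}$, $\mathbf e_{test}$ independent copies of $z_1$ and of the first $p$ entries of $\mathbf e_1$, and $\mathbb E_{\cdot}$ denoting conditional expectation given everything except the variables in the subscript, let $$B=\|\hat\theta(\boldsymbol\Phi\theta^*)-\theta^*\|_{\boldsymbol\Lambda}^2,\qquad V=\mathbb E_{\boldsymbol\epsilon}\|\hat\theta(\boldsymbol\epsilon)\|^2_{\boldsymbol\Lambda},\qquad S_1=\mathbb E_{z_{test},\boldsymbol\epsilon}|\phi(z_{test})^\top(\mathbf W^\top\mathbf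 W-\mathbf I)\hat\theta(\mathbf y)|^2,$$ $$S_2=\frac{\sigma_x^2}{p}\mathbb E_{z_{test},\boldsymbol\epsilon}|\phi(z_{test})^\top\mathbf W^\top\mathbf E^\top\mathbf A^{-1}\mathbf y|^2,\qquad S_3=\frac{\sigma_x^2}{p^2}\mathbb E_{\mathbf e_{test},\boldsymbol\epsilon}|\mathbf e_{test}^\top\mathbf X^\top\mathbf A^{-1}\mathbf y|^2 .$$ **Theorem.** Suppose that $k_{\max}=O(1)$ and $\sup_{0\le j<k_{\max}}\beta_j=O(1)$ as $p\to\infty$. Let $p=p(n)\ge1$ be non-decreasing and $\gamma=\gamma(n)\ge0$ non-increasing in $n$, with $\max(\sigma_x,\gamma(n))>0$ for every $n$. Then there are constants $C_1,C_2$, $c>0$ and $N$ such that for all $n\ge N$ and all $\delta>0$, with probability at least $$1-\delta-\exp\Big(-\frac{c\,n}{\max(1,k_{\max})}\Big)-C_2\,\frac{n^2}{p}\,\frac{v_1+\sigma_x^2v_2+\sigma_x^4v_3}{(\sigma_x^2+n\gamma)^2},$$ the matrix $\mathbf A$ is invertible and the following three bounds hold simultaneously: $$V\le C_1\frac{\sigma_y^2k_{\max}}{n},\qquad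 B\le C_1\frac{\|\theta^*\|^2_{\boldsymbol\Lambda^{-1}}}{n^2}(\sigma_x^2+n\gamma)^2,$$ $$S_1+S_2+S_3\le C_1\frac{n^2}{\delta p}\,\frac{(v_1+\sigma_x^2v_2+\sigma_x^4)\big(\sup_z|g(z)|^2+\sigma_y^2/n\big)}{(\sigma_x^2+n\gamma)^2}.$$ -/

import Mathlib

open MeasureTheory ProbabilityTheory Filter Topology
open scoped Matrix Asymptotics

/-- The Latent Metric Model together with the regression responses.  The latent points are `z i`,
the random functions are `ω ↦ ψ j (ξ ω)`, where the random element `ξ` carries all the randomness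
of `ψ` (so that "`ψ` is independent of `z`" has its usual meaning also for `ψ j (ξ ω) (z i ω)`),
the covariate noise is the array `E i j`, and the response noise is `ε i`.  Samples `i` and
features `j` are numbered from `0`; the model with `p` features uses `j = 0, …, p - 1`. -/
structure LatentMetricModel (Ω Ξ 𝒵 : Type*) [MeasurableSpace Ω] [MeasurableSpace Ξ]
    [MetricSpace 𝒵] [MeasurableSpace 𝒵] (P : Measure Ω) (μ : Measure 𝒵) where
  z : ℕ → Ω → 𝒵
  ξ : Ω → Ξ
  ψ : ℕ → Ξ → 𝒵 → ℝ
  E : ℕ → ℕ → Ω → ℝ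
  ε : ℕ → Ω → ℝ
  σx : ℝ
  σy : ℝ
  σx_nonneg : 0 ≤ σx
  σy_nonneg : 0 ≤ σy
  -- the latent points are i.i.d. with law `μ`
  measurable_z : ∀ i, Measurable (z i)
  map_z : ∀ i, P.map (z i) = μ
  iIndepFun_z : iIndepFun z P
  -- the random functions
  measurable_ξ : Measurable ξ
  measurable_ψ : ∀ j, Measurable (Function.uncurry (ψ j))
  -- the noise vectors `E i` are i.i.d. with independent, zero-mean, unit-variance entries
  measurable_E : ∀ i j, Measurable (E i j)
  iIndepFun_E : iIndepFun (fun ij : ℕ × ℕ => E ij.1 ij.2) P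
  identDistrib_E : ∀ i j, IdentDistrib (E i j) (E 0 j) P P
  memLp_E : ∀ i j, MemLp (E i j) 2 P
  mean_E : ∀ i j, ∫ ω, E i j ω ∂P = 0
  var_E : ∀ i j, ∫ ω, E i j ω ^ 2 ∂P = 1
  -- the response noise is i.i.d., zero-mean, with variance `σy ^ 2`
  measurable_ε : ∀ i, Measurable (ε i)
  iIndepFun_ε : iIndepFun ε P
  identDistrib_ε : ∀ i, IdentDistrib (ε i) (ε 0) P P
  memLp_ε : ∀ i, MemLp (ε i) 2 P
  mean_ε : ∀ i, ∫ ω, ε i ω ∂P = 0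
  var_ε : ∀ i, ∫ ω, ε i ω ^ 2 ∂P = σy ^ 2
  -- the four sources `z`, `ξ`, `E`, `ε` are mutually independent
  indep_z_ξ : IndepFun (fun ω i => z i ω) ξ P
  indep_zξ_E : IndepFun (fun ω => ((fun i => z i ω), ξ ω)) (fun ω (ij : ℕ × ℕ) => E ij.1 ij.2 ω) P
  indep_zξE_ε : IndepFun
    (fun ω => ((fun i => z i ω), ξ ω, (fun ij : ℕ × ℕ => E ij.1 ij.2 ω))) (fun ω i => ε i ω) P

namespace LatentMetricModel

noncomputable section

variable {Ω Ξ 𝒵 : Type*} [MeasurableSpace Ω] [MeasurableSpace Ξ]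
  [MetricSpace 𝒵] [MeasurableSpace 𝒵] {P : Measure Ω} {μ : Measure 𝒵}

/-- The value `ψ_j(z)`, a random variable. -/
def psi (M : LatentMetricModel Ω Ξ 𝒵 P μ) (j : ℕ) (ω : Ω) (z : 𝒵) : ℝ := M.ψ j (M.ξ ω) z

/-- Standing assumptions on the model: the `ψ_j` are pointwise square integrable and mean-square
continuous, fourth moments are uniformly bounded, and the `ψ_j` are mutually independent. -/
structure Regular (M : LatentMetricModel Ω Ξ 𝒵 P μ) : Prop where
  memLp_psi : ∀ j z, MemLp (fun ω => M.psi j ω z) 2 P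
  meanSquare_continuous : ∀ j z,
    Tendsto (fun z' => ∫ ω, |M.psi j ω z - M.psi j ω z'| ^ 2 ∂P) (𝓝 z) (𝓝 0)
  fourth_psi : ∃ C : ℝ, ∀ j z,
    MemLp (fun ω => M.psi j ω z) 4 P ∧ ∫ ω, |M.psi j ω z| ^ 4 ∂P ≤ C
  fourth_E : ∃ C : ℝ, ∀ i j, MemLp (M.E i j) 4 P ∧ ∫ ω, |M.E i j ω| ^ 4 ∂P ≤ C
  iIndepFun_psi : iIndepFun (fun j ω => M.psi j ω) P

/-- The implicit kernel `p⁻¹ 𝔼⟨ψ(z), ψ(z')⟩` of the model with `p` features. -/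
def implicitKernel (M : LatentMetricModel Ω Ξ 𝒵 P μ) (p : ℕ) (z z' : 𝒵) : ℝ :=
  (p : ℝ)⁻¹ * ∑ j : Fin p, ∫ ω, M.psi j ω z * M.psi j ω z' ∂P

/-- `v₁ = sup_{z,z'} p⁻¹ ∑_j Var[ψ_j(z) ψ_j(z')]`. -/
def v₁ (M : LatentMetricModel Ω Ξ 𝒵 P μ) (p : ℕ) : ℝ :=
  ⨆ w : 𝒵 × 𝒵, (p : ℝ)⁻¹ * ∑ j : Fin p, Var[fun ω => M.psi j ω w.1 * M.psi j ω w.2; P]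

/-- `v₂ = sup_z p⁻¹ ∑_j 𝔼|ψ_j(z)|²`. -/
def v₂ (M : LatentMetricModel Ω Ξ 𝒵 P μ) (p : ℕ) : ℝ :=
  ⨆ z : 𝒵, (p : ℝ)⁻¹ * ∑ j : Fin p, ∫ ω, |M.psi j ω z| ^ 2 ∂P

/-- `v₃ = sup_{i,j} 𝔼|E_{ij}|⁴`, which is the common value `𝔼|E_{ij}|⁴` when the entries are
identically distributed. -/
def v₃ (M : LatentMetricModel Ω Ξ 𝒵 P μ) : ℝ :=
  ⨆ ij : ℕ × ℕ, ∫ ω, |M.E ij.1 ij.2 ω| ^ 4 ∂P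

/-- The data matrix `X`, with entries `ψ_j(z_i) + σx E_{ij}`. -/
def X (M : LatentMetricModel Ω Ξ 𝒵 P μ) (n p : ℕ) (ω : Ω) : Matrix (Fin n) (Fin p) ℝ :=
  Matrix.of fun i j => M.psi j ω (M.z i ω) + M.σx * M.E i j ω

/-- The matrix `A = p⁻¹ X Xᵀ + n γ I`. -/
def A (M : LatentMetricModel Ω Ξ 𝒵 P μ) (n p : ℕ) (γ : ℝ) (ω : Ω) : Matrix (Fin n) (Fin n) ℝ :=
  (p : ℝ)⁻¹ • (M.X n p ω * (M.X n p ω)ᵀ) + ((n : ℝ) * γ) • (1 : Matrix (Fin n) (Fin n) ℝ)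

end

end LatentMetricModel

/-- `lam`, `u` enumerate the non-zero eigenvalues (in non-increasing order, with multiplicity)
and corresponding orthonormal eigenfunctions of the integral operator with kernel `κ` on `L²(μ)`,
there being exactly `r` of them: whatever is orthogonal to all the `u l` is in the null space. -/
structure IsEigensystem {𝒵 : Type*} [MeasurableSpace 𝒵] (μ : Measure 𝒵) (κ : 𝒵 → 𝒵 → ℝ)
    {r : ℕ} (lam : Fin r → ℝ) (u : Fin r → 𝒵 → ℝ) : Prop where
  pos : ∀ l, 0 < lam l
  antitone : Antitone lam
  memLp : ∀ l, MemLp (u l) 2 μ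
  orthonormal : ∀ l m, ∫ z, u l z * u m z ∂μ = if l = m then 1 else 0
  eigen : ∀ l z, ∫ z', κ z z' * u l z' ∂μ = lam l * u l z
  complete : ∀ f : 𝒵 → ℝ, MemLp f 2 μ → (∀ l, ∫ z, f z * u l z ∂μ = 0) →
    ∀ᵐ z ∂μ, ∫ z', κ z z' * f z' ∂μ = 0

noncomputable section

/-- The feature map `φ(z) = (λ_l^{1/2} u_l(z))_l`. -/
def featureMap {𝒵 : Type*} {r : ℕ} (lam : Fin r → ℝ) (u : Fin r → 𝒵 → ℝ) (z : 𝒵) : Fin r → ℝ :=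
  fun l => √(lam l) * u l z

/-- The coefficient `β_k`, for `0 ≤ k < r`.  The coordinates "`≤ k`" are those with index
`0, …, k - 1`.  For `k = 0` the first term is absent (it reads `0 / 0 = 0` here). -/
def betaCoeff {𝒵 : Type*} {r : ℕ} (lam : Fin r → ℝ) (u : Fin r → 𝒵 → ℝ) (k : ℕ) : ℝ :=
  ⨆ z : 𝒵, max ((∑ l : Fin r with l.val < k, u l z ^ 2) / k)
    (max ((∑ l : Fin r with k ≤ l.val, featureMap lam u z l ^ 2) / ∑ l : Fin r with k ≤ l.val, lam l)
      ((∑ l : Fin r with k ≤ l.val, lam l * featureMap lam u z l ^ 2) /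
        ∑ l : Fin r with k ≤ l.val, lam l ^ 2))

/-- `sup_k β_k` over `0 ≤ k < r`. -/
def supBeta {𝒵 : Type*} {r : ℕ} (lam : Fin r → ℝ) (u : Fin r → 𝒵 → ℝ) : ℝ :=
  ⨆ k : Fin r, betaCoeff lam u k

/-- `‖v‖²_D = vᵀ D v` for the diagonal matrix `D` with diagonal `d`. -/
def diagNormSq {r : ℕ} (d v : Fin r → ℝ) : ℝ := v ⬝ᵥ (Matrix.diagonal d *ᵥ v)

namespace LatentMetricModel

variable {Ω Ξ 𝒵 : Type*} [MeasurableSpace Ω] [MeasurableSpace Ξ]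
  [MetricSpace 𝒵] [MeasurableSpace 𝒵] {P : Measure Ω} {μ : Measure 𝒵}

/-- The matrix `Φ` with rows `φ(z_i)`. -/
def Phi (M : LatentMetricModel Ω Ξ 𝒵 P μ) (n : ℕ) {r : ℕ} (lam : Fin r → ℝ) (u : Fin r → 𝒵 → ℝ)
    (ω : Ω) : Matrix (Fin n) (Fin r) ℝ :=
  Matrix.of fun i => featureMap lam u (M.z i ω)

/-- The matrix `W`, with entries `(λ_l p)^{-1/2} ∫ ψ_j u_l dμ`. -/
def W (M : LatentMetricModel Ω Ξ 𝒵 P μ) (p : ℕ) {r : ℕ} (lam : Fin r → ℝ) (u : Fin r → 𝒵 → ℝ)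
    (ω : Ω) : Matrix (Fin p) (Fin r) ℝ :=
  Matrix.of fun j l => (√(lam l * p))⁻¹ * ∫ z, M.psi j ω z * u l z ∂μ

/-- The noise matrix `E` of the first `n` samples and the first `p` features. -/
def noise (M : LatentMetricModel Ω Ξ 𝒵 P μ) (n p : ℕ) (ω : Ω) : Matrix (Fin n) (Fin p) ℝ :=
  Matrix.of fun i j => M.E i j ω

/-- The first `n` response disturbances. -/
def eps (M : LatentMetricModel Ω Ξ 𝒵 P μ) (n : ℕ) (ω : Ω) : Fin n → ℝ := fun i => M.ε i ω

/-- The response vector `y_i = g(z_i) + ε_i`, where the latent points are taken at `ω` and the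
disturbances at `ω'`. -/
def y (M : LatentMetricModel Ω Ξ 𝒵 P μ) (n : ℕ) (g : 𝒵 → ℝ) (ω ω' : Ω) : Fin n → ℝ :=
  fun i => g (M.z i ω) + M.ε i ω'

/-- `θ̂(ỹ) = Φᵀ A⁻¹ ỹ`. -/
def thetaHat (M : LatentMetricModel Ω Ξ 𝒵 P μ) (n p : ℕ) (γ : ℝ) {r : ℕ} (lam : Fin r → ℝ)
    (u : Fin r → 𝒵 → ℝ) (ω : Ω) (y : Fin n → ℝ) : Fin r → ℝ :=
  (M.Phi n lam u ω)ᵀ *ᵥ ((M.A n p γ ω)⁻¹ *ᵥ y)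

/-! The terms of the risk decomposition.  A conditional expectation given everything except
`ε`, `z_test`, `e_test` is, these being independent of the rest, the integral over their laws
with the other variables held fixed at `ω`.  The law of `z_test` is `μ`, and that of `e_test` is
the law of the noise vector with index `0`. -/

/-- The bias term `B = ‖θ̂(Φθ) - θ‖²_Λ`. -/
def B (M : LatentMetricModel Ω Ξ 𝒵 P μ) (n p : ℕ) (γ : ℝ) {r : ℕ} (lam : Fin r → ℝ)
    (u : Fin r → 𝒵 → ℝ) (θ : Fin r → ℝ) (ω : Ω) : ℝ :=
  diagNormSq lam (M.thetaHat n p γ lam u ω (M.Phi n lam u ω *ᵥ θ) - θ)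

/-- The variance term `V = 𝔼_ε ‖θ̂(ε)‖²_Λ`. -/
def V (M : LatentMetricModel Ω Ξ 𝒵 P μ) (n p : ℕ) (γ : ℝ) {r : ℕ} (lam : Fin r → ℝ)
    (u : Fin r → 𝒵 → ℝ) (ω : Ω) : ℝ :=
  ∫ ω', diagNormSq lam (M.thetaHat n p γ lam u ω (M.eps n ω')) ∂P

/-- `S₁ = 𝔼_{z_test, ε} |φ(z_test)ᵀ (WᵀW - I) θ̂(y)|²`. -/
def S₁ (M : LatentMetricModel Ω Ξ 𝒵 P μ) (n p : ℕ) (γ : ℝ) {r : ℕ} (lam : Fin r → ℝ)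
    (u : Fin r → 𝒵 → ℝ) (g : 𝒵 → ℝ) (ω : Ω) : ℝ :=
  ∫ zt, ∫ ω', |featureMap lam u zt ⬝ᵥ
    (((M.W p lam u ω)ᵀ * M.W p lam u ω - 1) *ᵥ M.thetaHat n p γ lam u ω (M.y n g ω ω'))| ^ 2 ∂P ∂μ

/-- `S₂ = (σx² / p) 𝔼_{z_test, ε} |φ(z_test)ᵀ Wᵀ Eᵀ A⁻¹ y|²`. -/
def S₂ (M : LatentMetricModel Ω Ξ 𝒵 P μ) (n p : ℕ) (γ : ℝ) {r : ℕ} (lam : Fin r → ℝ)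
    (u : Fin r → 𝒵 → ℝ) (g : 𝒵 → ℝ) (ω : Ω) : ℝ :=
  M.σx ^ 2 / p * ∫ zt, ∫ ω', |featureMap lam u zt ⬝ᵥ ((M.W p lam u ω)ᵀ *ᵥ
    ((M.noise n p ω)ᵀ *ᵥ ((M.A n p γ ω)⁻¹ *ᵥ M.y n g ω ω')))| ^ 2 ∂P ∂μ

/-- `S₃ = (σx² / p²) 𝔼_{e_test, ε} |e_testᵀ Xᵀ A⁻¹ y|²`. -/
def S₃ (M : LatentMetricModel Ω Ξ 𝒵 P μ) (n p : ℕ) (γ : ℝ) (g : 𝒵 → ℝ) (ω : Ω) : ℝ :=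
  M.σx ^ 2 / (p : ℝ) ^ 2 * ∫ ωt, ∫ ω', |(fun j : Fin p => M.E 0 j ωt) ⬝ᵥ
    ((M.X n p ω)ᵀ *ᵥ ((M.A n p γ ω)⁻¹ *ᵥ M.y n g ω ω'))| ^ 2 ∂P ∂P

end LatentMetricModel

end

/-! Write U for the matrix of eigenfunction values at the sample, D for the diagonal matrix of
eigenvalues, and s = σx² + nγ. The kernel is continuous, has finite rank, and `μ` has full support,
so Mercer's identity is a finite sum valid at every pair of points (`IsEigensystem.kernel_eq_sum`).
Hence A = U D Uᵀ + s I + Δ, where Δ is the fluctuation of p⁻¹XXᵀ around its mean given the latent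
points.

Two events make A well behaved. Independence across features bounds the second moment of each entry
of Δ by a multiple of (v₁ + σx²v₂ + σx⁴v₃)/p, so Markov's inequality for the Frobenius norm gives
‖Δ‖ ≤ s/2 (`Regular.measure_perturbation_le`); this costs the C₂ term of the probability. The β
coefficients bound the eigenfunctions uniformly, so Hoeffding's inequality and a union bound give
‖UᵀU − nI‖ ≤ n/2 (`measure_gram_deviation_le`); this costs the exponential term.

On these events V and B are linear algebra (`ridge_smoother_bounds`). With H = U(UᵀU)⁻¹ one has UᵀH
= I, so AH = UD + (sI + Δ)H. This yields ‖A⁻¹UD‖ ≤ 4‖H‖ and ‖DUᵀA⁻¹UD − D‖ ≤ 6s‖H‖², while ‖H‖² ≤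
2/n. No lower bound on the eigenvalues enters.

Each of S₁, S₂, S₃ averages the square of q·A⁻¹y, where the weights q depend on the test variables.
Integrating out ε bounds it by ‖A⁻¹‖²(n sup|g|² + σy²)‖q‖², with ‖A⁻¹‖ ≤ 2/s. The Karhunen-Loève
expansion has no remainder here (`Regular.ae_psi_eq_sum`), so Wφ(z) = ψ(z)/√p, which identifies q:
kernel deviations for S₁, feature-noise correlations for S₂, and X e_test for S₃. Markov's
inequality for the three mean values of ‖q‖², at level δ/3 each, costs the δ. -/

set_option linter.unusedSectionVars false

/-! ### Operator norm bounds for perturbed ridge matrices -/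

section RidgeAlgebra

open scoped Matrix.Norms.L2Operator

variable {m n r : ℕ}

lemma sum_sq_mulVec_le_l2_opNorm (M : Matrix (Fin m) (Fin n) ℝ) (x : Fin n → ℝ) :
    ∑ i, (M *ᵥ x) i ^ 2 ≤ ‖M‖ ^ 2 * ∑ j, x j ^ 2 := by
  have h := Matrix.l2_opNorm_mulVec M (WithLp.toLp 2 x)
  have h2 := pow_le_pow_left₀ (norm_nonneg _) h 2
  rw [mul_pow, EuclideanSpace.real_norm_sq_eq, EuclideanSpace.real_norm_sq_eq] at h2
  simpa using h2

lemma l2_opNorm_le_of_forall_sum_sq {M : Matrix (Fin m) (Fin n) ℝ} {c : ℝ} (hc : 0 ≤ c)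
    (h : ∀ x : Fin n → ℝ, ∑ i, (M *ᵥ x) i ^ 2 ≤ c ^ 2 * ∑ j, x j ^ 2) : ‖M‖ ≤ c := by
  rw [Matrix.l2_opNorm_def]
  refine ContinuousLinearMap.opNorm_le_bound _ hc fun x => ?_
  refine le_of_sq_le_sq ?_ (by positivity)
  rw [mul_pow, EuclideanSpace.real_norm_sq_eq, EuclideanSpace.real_norm_sq_eq]
  simpa using h x.ofLp

/-- The Frobenius norm dominates the operator norm, so random matrices need only be controlled entry
by entry. -/
lemma l2_opNorm_le_of_sum_sum_sq {M : Matrix (Fin m) (Fin n) ℝ} {c : ℝ} (hc : 0 ≤ c)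
    (h : ∑ i, ∑ j, M i j ^ 2 ≤ c ^ 2) : ‖M‖ ≤ c := by
  refine l2_opNorm_le_of_forall_sum_sq hc fun x => ?_
  refine le_trans ?_ (mul_le_mul_of_nonneg_right h (by positivity))
  rw [Finset.sum_mul]
  refine Finset.sum_le_sum fun i _ => ?_
  rw [Matrix.mulVec, dotProduct]
  exact Finset.sum_mul_sq_le_sq_mul_sq _ _ _

lemma l2_opNorm_one_le : ‖(1 : Matrix (Fin n) (Fin n) ℝ)‖ ≤ 1 :=
  l2_opNorm_le_of_forall_sum_sq zero_le_one (by simp)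

lemma l2_opNorm_transpose (M : Matrix (Fin m) (Fin n) ℝ) : ‖Mᵀ‖ = ‖M‖ := by
  rw [← Matrix.conjTranspose_eq_transpose_of_trivial, Matrix.l2_opNorm_conjTranspose]

lemma abs_dotProduct_mulVec_le (M : Matrix (Fin n) (Fin n) ℝ) (x : Fin n → ℝ) :
    |x ⬝ᵥ (M *ᵥ x)| ≤ ‖M‖ * ∑ i, x i ^ 2 := by
  refine abs_le_of_sq_le_sq ?_ (by positivity)
  refine (Finset.sum_mul_sq_le_sq_mul_sq _ _ _).trans ?_
  refine (mul_le_mul_of_nonneg_left (sum_sq_mulVec_le_l2_opNorm M x) (by positivity)).trans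
    (le_of_eq (by ring))

/-- A coercive matrix is invertible, with a bound on its inverse. -/
lemma isUnit_and_l2_opNorm_inv_le {M : Matrix (Fin n) (Fin n) ℝ} {c : ℝ} (hc : 0 < c)
    (h : ∀ x : Fin n → ℝ, c * ∑ i, x i ^ 2 ≤ x ⬝ᵥ (M *ᵥ x)) : IsUnit M ∧ ‖M⁻¹‖ ≤ c⁻¹ := by
  -- Cauchy-Schwarz turns coercivity into ‖Mx‖ ≥ c‖x‖, which gives both injectivity and the bound on
  -- the inverse.
  have key : ∀ x : Fin n → ℝ, c ^ 2 * ∑ i, x i ^ 2 ≤ ∑ i, (M *ᵥ x) i ^ 2 := by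
    intro x
    have h1 : (x ⬝ᵥ (M *ᵥ x)) ^ 2 ≤ (∑ i, x i ^ 2) * ∑ i, (M *ᵥ x) i ^ 2 :=
      Finset.sum_mul_sq_le_sq_mul_sq _ _ _
    have h0 : 0 ≤ ∑ i, x i ^ 2 := by positivity
    rcases h0.eq_or_lt with h0 | h0
    · rw [← h0, mul_zero]; positivity
    · have h2 := pow_le_pow_left₀ (by positivity) (h x) 2
      refine le_of_mul_le_mul_left (le_trans ?_ (h2.trans h1)) h0
      exact le_of_eq (by ring)
  have hu : IsUnit M := by
    rw [← Matrix.mulVec_injective_iff_isUnit]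
    rw [← Matrix.coe_mulVecLin]
    refine (injective_iff_map_eq_zero M.mulVecLin).2 fun x hx => ?_
    have hx' : M *ᵥ x = 0 := hx
    have h1 := key x
    rw [hx'] at h1
    have h2 : ∑ i, x i ^ 2 ≤ 0 := by
      simp only [Pi.zero_apply, ne_eq, OfNat.ofNat_ne_zero, not_false_eq_true, zero_pow,
        Finset.sum_const_zero] at h1
      exact nonpos_of_mul_nonpos_right h1 (by positivity)
    have h3 := (Finset.sum_eq_zero_iff_of_nonneg (fun i _ => sq_nonneg (x i))).1
      (le_antisymm h2 (by positivity))
    ext i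
    simpa using h3 i (Finset.mem_univ i)
  refine ⟨hu, l2_opNorm_le_of_forall_sum_sq (by positivity) fun x => ?_⟩
  have h1 := key (M⁻¹ *ᵥ x)
  rw [Matrix.mulVec_mulVec, Matrix.mul_nonsing_inv _ ((Matrix.isUnit_iff_isUnit_det M).1 hu),
    Matrix.one_mulVec] at h1
  rw [inv_pow, inv_mul_eq_div, le_div_iff₀ (by positivity), mul_comm]
  exact h1

variable {A Δ : Matrix (Fin n) (Fin n) ℝ} {U : Matrix (Fin n) (Fin r) ℝ} {lam : Fin r → ℝ} {s : ℝ}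

/-- A ridge-regularized covariance matrix is stable under perturbations that are small compared
with the regularization. -/
lemma ridge_isUnit_and_inv_le (hlam : ∀ l, 0 ≤ lam l) (hs : 0 < s)
    (hA : A = U * Matrix.diagonal lam * Uᵀ + s • 1 + Δ) (hΔ : ‖Δ‖ ≤ s / 2) :
    IsUnit A ∧ ‖A⁻¹‖ ≤ 2 / s := by
  rw [← inv_div]
  refine isUnit_and_l2_opNorm_inv_le (by positivity) fun x => ?_
  have h1 : x ⬝ᵥ ((U * Matrix.diagonal lam * Uᵀ) *ᵥ x) = ∑ l, lam l * (Uᵀ *ᵥ x) l ^ 2 := by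
    rw [Matrix.mul_assoc, ← Matrix.mulVec_mulVec, Matrix.dotProduct_mulVec,
      ← Matrix.mulVec_transpose, ← Matrix.mulVec_mulVec, dotProduct]
    refine Finset.sum_congr rfl fun l _ => ?_
    rw [Matrix.mulVec_diagonal]
    ring
  have h2 : 0 ≤ ∑ l, lam l * (Uᵀ *ᵥ x) l ^ 2 :=
    Finset.sum_nonneg fun l _ => mul_nonneg (hlam l) (sq_nonneg _)
  have h3 : x ⬝ᵥ ((s • (1 : Matrix (Fin n) (Fin n) ℝ)) *ᵥ x) = s * ∑ i, x i ^ 2 := by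
    rw [Matrix.smul_mulVec, Matrix.one_mulVec, dotProduct_smul, smul_eq_mul, dotProduct]
    simp_rw [sq]
  have h4 := (abs_le.1 (abs_dotProduct_mulVec_le Δ x)).1
  have h5 : ‖Δ‖ * ∑ i, x i ^ 2 ≤ s / 2 * ∑ i, x i ^ 2 :=
    mul_le_mul_of_nonneg_right hΔ (by positivity)
  rw [hA, Matrix.add_mulVec, Matrix.add_mulVec, dotProduct_add, dotProduct_add, h1, h3]
  linarith

/-- An almost orthogonal design has a well-conditioned Gram matrix. -/
lemma gram_isUnit_and_inv_le (hn : 0 < n)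
    (hU : ‖Uᵀ * U - (n : ℝ) • (1 : Matrix (Fin r) (Fin r) ℝ)‖ ≤ n / 2) :
    IsUnit (Uᵀ * U) ∧ ‖(Uᵀ * U)⁻¹‖ ≤ 2 / n := by
  have hn' : (0 : ℝ) < n := by exact_mod_cast hn
  rw [← inv_div]
  refine isUnit_and_l2_opNorm_inv_le (by positivity) fun x => ?_
  have h3 : x ⬝ᵥ (((n : ℝ) • (1 : Matrix (Fin r) (Fin r) ℝ)) *ᵥ x) = n * ∑ i, x i ^ 2 := by
    rw [Matrix.smul_mulVec, Matrix.one_mulVec, dotProduct_smul, smul_eq_mul, dotProduct]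
    simp_rw [sq]
  have h4 := (abs_le.1 (abs_dotProduct_mulVec_le
    (Uᵀ * U - (n : ℝ) • (1 : Matrix (Fin r) (Fin r) ℝ)) x)).1
  have h5 : ‖Uᵀ * U - (n : ℝ) • (1 : Matrix (Fin r) (Fin r) ℝ)‖ * ∑ i, x i ^ 2
      ≤ n / 2 * ∑ i, x i ^ 2 := mul_le_mul_of_nonneg_right hU (by positivity)
  rw [Matrix.sub_mulVec, dotProduct_sub, h3] at h4
  linarith

/-- For H = U(UᵀU)⁻¹ the product HᵀH collapses to the transpose of (UᵀU)⁻¹, and the C*-identity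
equates its norm with ‖H‖². -/
lemma gram_pinv_norm_sq_le (hn : 0 < n)
    (hU : ‖Uᵀ * U - (n : ℝ) • (1 : Matrix (Fin r) (Fin r) ℝ)‖ ≤ n / 2) :
    ‖U * (Uᵀ * U)⁻¹‖ ^ 2 ≤ 2 / n := by
  obtain ⟨hG, hGi⟩ := gram_isUnit_and_inv_le hn hU
  have hdet := (Matrix.isUnit_iff_isUnit_det _).1 hG
  have h := Matrix.l2_opNorm_conjTranspose_mul_self (U * (Uᵀ * U)⁻¹)
  rw [Matrix.conjTranspose_eq_transpose_of_trivial, Matrix.transpose_mul, Matrix.mul_assoc,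
    ← Matrix.mul_assoc Uᵀ, Matrix.mul_nonsing_inv _ hdet, Matrix.mul_one,
    l2_opNorm_transpose] at h
  rw [sq, ← h]
  exact hGi

/-- The right inverse H of Uᵀ satisfies AH = UD + RH with R = sI + Δ. Solving for UD gives A⁻¹UD = H
− A⁻¹RH; multiplying this by DUᵀ on the left leaves D − (A⁻¹UD)ᵀRH, so the bias is quadratic in ‖H‖
and D cancels. -/
lemma ridge_smoother_bounds (hn : 0 < n) (hlam : ∀ l, 0 ≤ lam l) (hs : 0 < s)
    (hA : A = U * Matrix.diagonal lam * Uᵀ + s • 1 + Δ) (hAs : Aᵀ = A) (hΔ : ‖Δ‖ ≤ s / 2)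
    (hU : ‖Uᵀ * U - (n : ℝ) • (1 : Matrix (Fin r) (Fin r) ℝ)‖ ≤ n / 2) :
    ‖A⁻¹ * (U * Matrix.diagonal lam)‖ ^ 2 ≤ 32 / n ∧
    ‖Matrix.diagonal lam * Uᵀ * A⁻¹ * (U * Matrix.diagonal lam) - Matrix.diagonal lam‖ ≤
      12 * s / n := by
  have hn' : (0 : ℝ) < n := by exact_mod_cast hn
  obtain ⟨hAu, hAi⟩ := ridge_isUnit_and_inv_le hlam hs hA hΔ
  have hAdet := (Matrix.isUnit_iff_isUnit_det _).1 hAu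
  have hGdet := (Matrix.isUnit_iff_isUnit_det _).1 (gram_isUnit_and_inv_le hn hU).1
  have hH := gram_pinv_norm_sq_le hn hU
  set H := U * (Uᵀ * U)⁻¹ with hHdef
  set R := s • (1 : Matrix (Fin n) (Fin n) ℝ) + Δ with hR
  set D := Matrix.diagonal lam with hD
  have hUH : Uᵀ * H = 1 := by
    rw [hHdef, ← Matrix.mul_assoc, Matrix.mul_nonsing_inv _ hGdet]
  have hAH : A * H = U * D + R * H := by
    rw [hA, add_assoc, Matrix.add_mul, Matrix.mul_assoc, hUH, Matrix.mul_one]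
  have hM : A⁻¹ * (U * D) = H - A⁻¹ * (R * H) := by
    rw [eq_sub_of_add_eq hAH.symm, Matrix.mul_sub, ← Matrix.mul_assoc,
      Matrix.nonsing_inv_mul _ hAdet, Matrix.one_mul]
  have hRn : ‖R‖ ≤ 3 / 2 * s := by
    refine (norm_add_le _ _).trans ?_
    rw [norm_smul, Real.norm_of_nonneg hs.le]
    nlinarith [l2_opNorm_one_le (n := n)]
  have hRH : ‖R * H‖ ≤ 3 / 2 * s * ‖H‖ :=
    (Matrix.l2_opNorm_mul _ _).trans (mul_le_mul_of_nonneg_right hRn (norm_nonneg _))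
  -- The constant is 1 + (2/s)(3s/2) = 4.
  have hMn : ‖A⁻¹ * (U * D)‖ ≤ 4 * ‖H‖ := by
    rw [hM]
    refine (norm_sub_le _ _).trans ?_
    have h1 : ‖A⁻¹ * (R * H)‖ ≤ 2 / s * (3 / 2 * s * ‖H‖) :=
      (Matrix.l2_opNorm_mul _ _).trans (mul_le_mul hAi hRH (norm_nonneg _) (by positivity))
    have h2 : 2 / s * (3 / 2 * s * ‖H‖) = 3 * ‖H‖ := by field_simp
    linarith
  refine ⟨?_, ?_⟩
  · calc _ ≤ (4 * ‖H‖) ^ 2 := pow_le_pow_left₀ (norm_nonneg _) hMn 2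
      _ = 16 * ‖H‖ ^ 2 := by ring
      _ ≤ 16 * (2 / n) := by gcongr
      _ = 32 / n := by ring
  · have ht : (A⁻¹ * (U * D))ᵀ = D * Uᵀ * A⁻¹ := by
      rw [Matrix.transpose_mul, Matrix.transpose_mul, Matrix.transpose_nonsing_inv, hAs, hD,
        Matrix.diagonal_transpose]
    have hb : D * Uᵀ * A⁻¹ * (U * D) - D = -((A⁻¹ * (U * D))ᵀ * (R * H)) := by
      rw [Matrix.mul_assoc (D * Uᵀ), hM, Matrix.mul_sub, ← hM, ht, Matrix.mul_assoc D Uᵀ H, hUH,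
        Matrix.mul_one, Matrix.mul_assoc (D * Uᵀ)]
      abel
    rw [hb, norm_neg]
    refine (Matrix.l2_opNorm_mul _ _).trans ?_
    rw [l2_opNorm_transpose]
    calc _ ≤ (4 * ‖H‖) * (3 / 2 * s * ‖H‖) := by gcongr
      _ = 6 * s * ‖H‖ ^ 2 := by ring
      _ ≤ 6 * s * (2 / n) := by gcongr
      _ = 12 * s / n := by ring

/-- Coordinate form of the stability bounds for ridge regression with an almost orthogonal design
and a small perturbation. -/
theorem ridge_bounds (hlam : ∀ l, 0 ≤ lam l) (hs : 0 < s)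
    (hA : A = U * Matrix.diagonal lam * Uᵀ + s • 1 + Δ) (hAs : Aᵀ = A)
    (hΔ : ∑ i, ∑ j, Δ i j ^ 2 ≤ (s / 2) ^ 2) :
    IsUnit A ∧ (∀ q : Fin n → ℝ, ∑ i, (q ᵥ* A⁻¹) i ^ 2 ≤ 4 / s ^ 2 * ∑ i, q i ^ 2) ∧
    (0 < n → ∑ l, ∑ m, (Uᵀ * U - (n : ℝ) • (1 : Matrix (Fin r) (Fin r) ℝ)) l m ^ 2 ≤
        ((n : ℝ) / 2) ^ 2 →
      (∀ l, ∑ i, (A⁻¹ * (U * Matrix.diagonal lam)) i l ^ 2 ≤ 32 / n) ∧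
      ∀ x : Fin r → ℝ, ∑ l, ((Matrix.diagonal lam * Uᵀ * A⁻¹ * (U * Matrix.diagonal lam) -
        Matrix.diagonal lam) *ᵥ x) l ^ 2 ≤ (12 * s / n) ^ 2 * ∑ l, x l ^ 2) := by
  have hΔ' := l2_opNorm_le_of_sum_sum_sq (by positivity) hΔ
  obtain ⟨hAu, hAi⟩ := ridge_isUnit_and_inv_le hlam hs hA hΔ'
  refine ⟨hAu, fun q => ?_, fun hn hU => ?_⟩
  · rw [← Matrix.mulVec_transpose, Matrix.transpose_nonsing_inv, hAs]
    refine (sum_sq_mulVec_le_l2_opNorm _ _).trans ?_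
    have : ‖A⁻¹‖ ^ 2 ≤ (2 / s) ^ 2 := by gcongr
    rw [div_pow] at this
    norm_num at this
    gcongr
  · obtain ⟨h1, h2⟩ := ridge_smoother_bounds hn hlam hs hA hAs hΔ'
      (l2_opNorm_le_of_sum_sum_sq (by positivity) hU)
    refine ⟨fun l => ?_, fun x => ?_⟩
    · have h := sum_sq_mulVec_le_l2_opNorm (A⁻¹ * (U * Matrix.diagonal lam)) (Pi.single l 1)
      have h3 : ∑ j, (Pi.single l 1 : Fin r → ℝ) j ^ 2 = 1 := by
        rw [Finset.sum_eq_single l] <;> simp +contextual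
      rw [h3, mul_one, Matrix.mulVec_single_one] at h
      exact h.trans h1
    · refine (sum_sq_mulVec_le_l2_opNorm _ _).trans ?_
      gcongr

end RidgeAlgebra

/-! ### Continuity of second moments -/

section SecondMoments

variable {Ω 𝒵 : Type*} [MeasurableSpace Ω] {P : Measure Ω} [TopologicalSpace 𝒵]

/-- A mean-square continuous process has a jointly continuous second moment function. -/
lemma continuous_integral_mul_of_meanSquare {Y : Ω → 𝒵 → ℝ}
    (hY : ∀ z, MemLp (fun ω => Y ω z) 2 P)
    (hc : ∀ z, Tendsto (fun z' => ∫ ω, |Y ω z - Y ω z'| ^ 2 ∂P) (𝓝 z) (𝓝 0)) :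
    Continuous fun w : 𝒵 × 𝒵 => ∫ ω, Y ω w.1 * Y ω w.2 ∂P := by
  -- Mean-square continuity says that the process is a continuous curve in L²(P); the second moment
  -- function is then an inner product of two such curves.
  have hL : Continuous fun z => (hY z).toLp (fun ω => Y ω z) := by
    refine continuous_iff_continuousAt.2 fun z => ?_
    refine tendsto_iff_norm_sub_tendsto_zero.2 ?_
    have h := (hc z).sqrt
    rw [Real.sqrt_zero] at h
    refine h.congr fun z' => ?_
    rw [← Real.sqrt_sq (norm_nonneg _), ← MemLp.toLp_sub, ← real_inner_self_eq_norm_sq, L2.inner_def]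
    congr 1
    refine integral_congr_ae ?_
    filter_upwards [((hY z').sub (hY z)).coeFn_toLp] with ω hω
    rw [hω, sq_abs]
    simp only [Pi.sub_apply, real_inner_self_eq_norm_sq, Real.norm_eq_abs, sq_abs]
    ring
  have h2 : Continuous fun w : 𝒵 × 𝒵 =>
      inner ℝ ((hY w.1).toLp (fun ω => Y ω w.1)) ((hY w.2).toLp (fun ω => Y ω w.2)) :=
    (hL.comp continuous_fst).inner (hL.comp continuous_snd)
  refine h2.congr fun w => ?_
  rw [L2.inner_def]
  refine integral_congr_ae ?_
  filter_upwards [(hY w.1).coeFn_toLp, (hY w.2).coeFn_toLp] with ω h1 h2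
  rw [h1, h2]
  simp [mul_comm]

lemma sq_integral_le_integral_sq [IsProbabilityMeasure P] {f : Ω → ℝ} (hf : MemLp f 2 P) :
    (∫ ω, f ω ∂P) ^ 2 ≤ ∫ ω, f ω ^ 2 ∂P := by
  have h := variance_nonneg f P
  rw [variance_eq_sub hf] at h
  simpa using h

end SecondMoments

/-! ### Mercer's identity in finite rank -/

section Mercer

variable {𝒵 : Type*} [TopologicalSpace 𝒵] [CompactSpace 𝒵] [SecondCountableTopology 𝒵]
  [MeasurableSpace 𝒵] [BorelSpace 𝒵] {μ : Measure 𝒵} [IsFiniteMeasure μ] {κ : 𝒵 → 𝒵 → ℝ} {r : ℕ}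
  {lam : Fin r → ℝ} {u : Fin r → 𝒵 → ℝ}

lemma exists_forall_abs_le_of_continuous {X : Type*} [TopologicalSpace X] [CompactSpace X]
    {f : X → ℝ} (hf : Continuous f) : ∃ C, ∀ x, |f x| ≤ C := by
  obtain ⟨C, hC⟩ := isCompact_univ.exists_bound_of_continuousOn hf.continuousOn
  exact ⟨C, fun x => hC x (Set.mem_univ x)⟩

lemma Continuous.memLp_of_compactSpace {f : 𝒵 → ℝ} (hf : Continuous f) (q : ENNReal) :
    MemLp f q μ := by
  obtain ⟨C, hC⟩ := exists_forall_abs_le_of_continuous hf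
  exact MemLp.of_bound hf.aestronglyMeasurable C (ae_of_all _ hC)

lemma continuous_integral_kernel_mul (hκ : Continuous (Function.uncurry κ)) {f : 𝒵 → ℝ}
    (hf : Integrable f μ) : Continuous fun z => ∫ z', κ z z' * f z' ∂μ := by
  obtain ⟨C, hC⟩ := exists_forall_abs_le_of_continuous hκ
  refine continuous_of_dominated (bound := fun z' => C * |f z'|) (fun z => ?_) (fun z => ?_)
    (hf.abs.const_mul C) (ae_of_all _ fun z' => ?_)
  · exact (hκ.comp (Continuous.prodMk_right z)).aestronglyMeasurable.mul hf.aestronglyMeasurable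
  · refine ae_of_all _ fun z' => ?_
    rw [norm_mul, Real.norm_eq_abs, Real.norm_eq_abs]
    exact mul_le_mul_of_nonneg_right (hC (z, z')) (abs_nonneg _)
  · exact (hκ.comp (Continuous.prodMk_left z')).mul continuous_const

/-- The eigenvalue equation holds at every point, so the eigenfunction equals its own image under a
smoothing operator, divided by a nonzero eigenvalue. -/
lemma IsEigensystem.continuous (h : IsEigensystem μ κ lam u) (hκ : Continuous (Function.uncurry κ))
    (l : Fin r) : Continuous (u l) := by
  have h1 := continuous_integral_kernel_mul hκ ((h.memLp l).integrable one_le_two)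
  refine (h1.const_mul (lam l)⁻¹).congr fun z => ?_
  rw [h.eigen, inv_mul_cancel_left₀ (h.pos l).ne']

/-- Mercer's theorem for a continuous symmetric kernel of finite rank. -/
theorem IsEigensystem.kernel_eq_sum [μ.IsOpenPosMeasure] (h : IsEigensystem μ κ lam u)
    (hκ : Continuous (Function.uncurry κ)) (z z' : 𝒵) :
    κ z z' = ∑ l, lam l * (u l z * u l z') := by
  have hu := h.continuous hκ
  have hκz : Continuous (κ z) := hκ.comp (Continuous.prodMk_right z)
  -- The remainder of κ(z, ·) after projection on the eigenfunctions. It is orthogonal to all of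
  -- them, hence in the null space, so that both parts of ∫R² = ∫κ(z, ·)R − ∑ λₗ uₗ(z)∫R uₗ vanish.
  set R : 𝒵 → ℝ := fun w => κ z w - ∑ l, lam l * (u l z * u l w) with hR
  have hRc : Continuous R := by fun_prop
  have hint : ∀ {f : 𝒵 → ℝ}, Continuous f → Integrable f μ := fun hf =>
    memLp_one_iff_integrable.1 (hf.memLp_of_compactSpace 1)
  have horth : ∀ m, ∫ w, R w * u m w ∂μ = 0 := by
    intro m
    have h1 : ∀ w, R w * u m w = κ z w * u m w - ∑ l, lam l * u l z * (u l w * u m w) := by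
      intro w
      simp only [hR, sub_mul, Finset.sum_mul]
      congr 1
      exact Finset.sum_congr rfl fun l _ => by ring
    have hum := hu m
    simp_rw [h1]
    rw [integral_sub (hint (by fun_prop)) (hint (by fun_prop)), h.eigen,
      integral_finsetSum _ fun l _ => hint (by fun_prop)]
    simp_rw [integral_const_mul, h.orthonormal]
    simp
  have hz : ∫ w, κ z w * R w ∂μ = 0 := by
    have h1 := h.complete R (hRc.memLp_of_compactSpace 2) horth
    -- Full support upgrades almost everywhere equality of continuous functions to equality at the
    -- chosen point z.
    have h2 := (continuous_integral_kernel_mul hκ (hint hRc)).ae_eq_iff_eq μ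
      (continuous_const (y := (0 : ℝ)))
    exact congrFun (h2.1 h1) z
  have hsq : ∫ w, R w * R w ∂μ = 0 := by
    have h1 : ∀ w, R w * R w = κ z w * R w - ∑ l, lam l * u l z * (R w * u l w) := by
      intro w
      conv_lhs => rw [hR]
      simp only [sub_mul, Finset.sum_mul]
      congr 1
      exact Finset.sum_congr rfl fun l _ => by ring
    simp_rw [h1]
    rw [integral_sub (hint (by fun_prop)) (hint (by fun_prop)), hz,
      integral_finsetSum _ fun l _ => hint (by fun_prop)]
    simp_rw [integral_const_mul, horth]
    simp
  have hR0 : R = 0 := by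
    have h1 := (integral_eq_zero_iff_of_nonneg (fun w => mul_self_nonneg (R w))
      (hint (hRc.mul hRc))).1 hsq
    have h2 := ((hRc.mul hRc).ae_eq_iff_eq μ (continuous_const (y := (0 : ℝ)))).1 h1
    funext w
    exact mul_self_eq_zero.1 (congrFun h2 w)
  exact sub_eq_zero.1 (congrFun hR0 z')

end Mercer

namespace LatentMetricModel

/-! ### Karhunen-Loève expansion of the random functions -/

section KarhunenLoeve

variable {Ω Ξ 𝒵 : Type*} [MeasurableSpace Ω] [MeasurableSpace Ξ]
  [MetricSpace 𝒵] [CompactSpace 𝒵] [MeasurableSpace 𝒵] [BorelSpace 𝒵] {P : Measure Ω}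
  [IsProbabilityMeasure P] {μ : Measure 𝒵} [IsProbabilityMeasure μ]
  {M : LatentMetricModel Ω Ξ 𝒵 P μ}

lemma measurable_uncurry_psi (M : LatentMetricModel Ω Ξ 𝒵 P μ) (j : ℕ) :
    Measurable fun w : Ω × 𝒵 => M.psi j w.1 w.2 :=
  (M.measurable_ψ j).comp ((M.measurable_ξ.comp measurable_fst).prodMk measurable_snd)

lemma measurable_psi (M : LatentMetricModel Ω Ξ 𝒵 P μ) (j : ℕ) (z : 𝒵) :
    Measurable fun ω => M.psi j ω z :=
  (M.measurable_uncurry_psi j).comp measurable_prodMk_right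

lemma Regular.continuous_integral_psi_mul (hM : M.Regular) (j : ℕ) :
    Continuous fun w : 𝒵 × 𝒵 => ∫ ω, M.psi j ω w.1 * M.psi j ω w.2 ∂P :=
  continuous_integral_mul_of_meanSquare (hM.memLp_psi j) (hM.meanSquare_continuous j)

lemma Regular.continuous_implicitKernel (hM : M.Regular) (p : ℕ) :
    Continuous (Function.uncurry (M.implicitKernel p)) := by
  refine continuous_const.mul (continuous_finsetSum _ fun j _ => ?_)
  exact hM.continuous_integral_psi_mul j

/-- Integrating over Ω first leaves z ↦ 𝔼ψ(z)², which is continuous on a compact space and so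
integrable. -/
lemma Regular.memLp_psi_prod (hM : M.Regular) (j : ℕ) :
    MemLp (fun w : Ω × 𝒵 => M.psi j w.1 w.2) 2 (P.prod μ) := by
  have hm := M.measurable_uncurry_psi j
  rw [memLp_two_iff_integrable_sq hm.aestronglyMeasurable,
    integrable_prod_iff' (hm.pow_const 2).aestronglyMeasurable]
  refine ⟨ae_of_all _ fun z => (hM.memLp_psi j z).integrable_sq, ?_⟩
  have hc : Continuous fun z => ∫ ω, M.psi j ω z * M.psi j ω z ∂P :=
    (hM.continuous_integral_psi_mul j).comp (continuous_id.prodMk continuous_id)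
  refine (memLp_one_iff_integrable.1 (hc.memLp_of_compactSpace (μ := μ) 1)).congr
    (ae_of_all _ fun z => ?_)
  simp only [Real.norm_eq_abs, sq]
  exact integral_congr_ae (ae_of_all _ fun ω => (abs_of_nonneg (mul_self_nonneg _)).symm)

lemma measurable_integral_psi_mul (M : LatentMetricModel Ω Ξ 𝒵 P μ) (j : ℕ) {f : 𝒵 → ℝ}
    (hf : Continuous f) : Measurable fun ω => ∫ z, M.psi j ω z * f z ∂μ := by
  have h : StronglyMeasurable fun w : Ω × 𝒵 => M.psi j w.1 w.2 * f w.2 :=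
    ((M.measurable_uncurry_psi j).mul (hf.measurable.comp measurable_snd)).stronglyMeasurable
  exact h.integral_prod_right.measurable

lemma Regular.memLp_psi_mul_prod (hM : M.Regular) (j : ℕ) {f : 𝒵 → ℝ} (hf : Continuous f) :
    MemLp (fun w : Ω × 𝒵 => M.psi j w.1 w.2 * f w.2) 2 (P.prod μ) := by
  obtain ⟨C, hC⟩ := exists_forall_abs_le_of_continuous hf
  refine ((hM.memLp_psi_prod j).const_mul C).mono ?_ (ae_of_all _ fun w => ?_)
  · exact ((M.measurable_uncurry_psi j).mul
      (hf.measurable.comp measurable_snd)).aestronglyMeasurable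
  · rw [norm_mul, norm_mul, mul_comm, Real.norm_eq_abs, Real.norm_eq_abs C]
    exact mul_le_mul_of_nonneg_right ((hC _).trans (le_abs_self C)) (norm_nonneg _)

lemma Regular.memLp_integral_psi_mul (hM : M.Regular) (j : ℕ) {f : 𝒵 → ℝ} (hf : Continuous f) :
    MemLp (fun ω => ∫ z, M.psi j ω z * f z ∂μ) 2 P := by
  have hm := M.measurable_integral_psi_mul (P := P) j hf
  have hL := (hM.memLp_psi_mul_prod j hf).integrable_sq
  rw [memLp_two_iff_integrable_sq hm.aestronglyMeasurable]
  refine hL.integral_prod_left.mono (hm.pow_const 2).aestronglyMeasurable ?_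
  filter_upwards [hL.prod_right_ae] with ω hω
  have hω' : MemLp (fun z => M.psi j ω z * f z) 2 μ :=
    (memLp_two_iff_integrable_sq (((M.measurable_uncurry_psi j).comp measurable_prodMk_left).mul
      hf.measurable).aestronglyMeasurable).2 hω
  rw [Real.norm_of_nonneg (sq_nonneg _),
    Real.norm_of_nonneg (integral_nonneg fun z => sq_nonneg _)]
  exact sq_integral_le_integral_sq hω'

lemma Regular.integral_mul_integral_psi_mul (hM : M.Regular) (j : ℕ) {f : 𝒵 → ℝ}
    (hf : Continuous f) {Y : Ω → ℝ} (hY : MemLp Y 2 P) :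
    ∫ ω, Y ω * ∫ z, M.psi j ω z * f z ∂μ ∂P = ∫ z, (∫ ω, Y ω * M.psi j ω z ∂P) * f z ∂μ := by
  have hI : Integrable (Function.uncurry fun ω z => Y ω * (M.psi j ω z * f z)) (P.prod μ) :=
    (hY.comp_fst μ).integrable_mul (hM.memLp_psi_mul_prod j hf)
  simp_rw [← integral_const_mul, ← integral_mul_const]
  rw [integral_integral_swap hI]
  simp_rw [mul_assoc]

/-- Karhunen-Loève expansion of the random functions at a fixed point. -/
theorem Regular.ae_psi_eq_sum [μ.IsOpenPosMeasure] (hM : M.Regular) {p r : ℕ} (hp : 1 ≤ p)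
    {lam : Fin r → ℝ} {u : Fin r → 𝒵 → ℝ} (h : IsEigensystem μ (M.implicitKernel p) lam u)
    (z : 𝒵) : ∀ᵐ ω ∂P, ∀ j : Fin p,
      M.psi j ω z = ∑ l, (∫ z', M.psi j ω z' * u l z' ∂μ) * u l z := by
  have hK := hM.continuous_implicitKernel p
  have hu := h.continuous hK
  have hp0 : (0 : ℝ) < (p : ℝ)⁻¹ := by positivity
  set c : Fin p → Fin r → Ω → ℝ := fun j l ω => ∫ z', M.psi j ω z' * u l z' ∂μ with hc
  have hcL : ∀ j l, MemLp (c j l) 2 P := fun j l => hM.memLp_integral_psi_mul j (hu l)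
  have hψ : ∀ (j : Fin p) z, MemLp (fun ω => M.psi j ω z) 2 P := fun j z => hM.memLp_psi j z
  -- Only averages over the features are diagonalized by the eigenfunctions; an individual `ψ j`
  -- need not have uncorrelated coefficients.
  have hψc : ∀ z l, (p : ℝ)⁻¹ * ∑ j : Fin p, ∫ ω, M.psi j ω z * c j l ω ∂P = lam l * u l z := by
    intro z l
    have h0 : ∀ j : Fin p, ∫ ω, M.psi j ω z * c j l ω ∂P
        = ∫ z', (∫ ω, M.psi j ω z * M.psi j ω z' ∂P) * u l z' ∂μ := fun j =>
      hM.integral_mul_integral_psi_mul j (hu l) (hM.memLp_psi j z)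
    simp_rw [h0]
    rw [← integral_finsetSum _ fun j _ => ?_, ← integral_const_mul, ← h.eigen l z]
    · simp_rw [implicitKernel, mul_assoc, Finset.sum_mul]
    · have h1 : Continuous fun z' => ∫ ω, M.psi j ω z * M.psi j ω z' ∂P :=
        (hM.continuous_integral_psi_mul j).comp (Continuous.prodMk_right z)
      exact memLp_one_iff_integrable.1 ((h1.mul (hu l)).memLp_of_compactSpace 1)
  have hcc : ∀ l m, (p : ℝ)⁻¹ * ∑ j : Fin p, ∫ ω, c j m ω * c j l ω ∂P = if l = m then lam m else 0 := by
    intro l m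
    have h1 : ∀ j : Fin p, ∫ ω, c j m ω * c j l ω ∂P
        = ∫ z', (∫ ω, M.psi j ω z' * c j m ω ∂P) * u l z' ∂μ := by
      intro j
      rw [hM.integral_mul_integral_psi_mul j (hu l) (hcL j m)]
      simp_rw [mul_comm (c j m _)]
    simp_rw [h1]
    rw [← integral_finsetSum _ fun j _ => ?_, ← integral_const_mul]
    · simp_rw [← Finset.sum_mul, ← mul_assoc, hψc, mul_assoc]
      rw [integral_const_mul, h.orthonormal]
      simp [eq_comm]
    · have h2 : Continuous fun z' => ∫ ω, M.psi j ω z' * c j m ω ∂P := by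
        have h0 : ∀ z', ∫ ω, M.psi j ω z' * c j m ω ∂P
            = ∫ w, (∫ ω, M.psi j ω z' * M.psi j ω w ∂P) * u m w ∂μ := fun z' =>
          hM.integral_mul_integral_psi_mul j (hu m) (hM.memLp_psi j z')
        simp_rw [h0]
        exact continuous_integral_kernel_mul (hM.continuous_integral_psi_mul j)
          (memLp_one_iff_integrable.1 ((hu m).memLp_of_compactSpace 1))
      exact memLp_one_iff_integrable.1 ((h2.mul (hu l)).memLp_of_compactSpace 1)
  have hD : ∀ j : Fin p, MemLp (fun ω => M.psi j ω z - ∑ l, c j l ω * u l z) 2 P := fun j =>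
    (hψ j z).sub (memLp_finsetSum _ fun l _ => (hcL j l).mul_const (u l z))
  have hDsq : ∀ j : Fin p, ∫ ω, (M.psi j ω z - ∑ l, c j l ω * u l z) ^ 2 ∂P
      = ∫ ω, M.psi j ω z * M.psi j ω z ∂P - 2 * ∑ l, u l z * ∫ ω, M.psi j ω z * c j l ω ∂P
        + ∑ l, ∑ m, u l z * u m z * ∫ ω, c j m ω * c j l ω ∂P := by
    intro j
    have h1 : ∀ ω, (M.psi j ω z - ∑ l, c j l ω * u l z) ^ 2 = M.psi j ω z * M.psi j ω z
        - 2 * ∑ l, u l z * (M.psi j ω z * c j l ω)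
        + ∑ l, ∑ m, u l z * u m z * (c j m ω * c j l ω) := by
      intro ω
      have h2 : ∑ l, u l z * (M.psi j ω z * c j l ω) = M.psi j ω z * ∑ l, c j l ω * u l z := by
        rw [Finset.mul_sum]
        exact Finset.sum_congr rfl fun l _ => by ring
      have h3 : ∑ l, ∑ m, u l z * u m z * (c j m ω * c j l ω) = (∑ l, c j l ω * u l z) ^ 2 := by
        rw [sq, Finset.sum_mul_sum]
        exact Finset.sum_congr rfl fun l _ => Finset.sum_congr rfl fun m _ => by ring
      rw [h2, h3]
      ring
    have i1 : ∀ l, Integrable (fun ω => u l z * (M.psi j ω z * c j l ω)) P := fun l =>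
      ((hψ j z).integrable_mul (hcL j l)).const_mul _
    have i2 : ∀ l m, Integrable (fun ω => u l z * u m z * (c j m ω * c j l ω)) P := fun l m =>
      ((hcL j m).integrable_mul (hcL j l)).const_mul _
    have i3 : Integrable (fun ω => ∑ l, ∑ m, u l z * u m z * (c j m ω * c j l ω)) P :=
      integrable_finsetSum _ fun l _ => integrable_finsetSum _ fun m _ => i2 l m
    have i4 : Integrable (fun ω => M.psi j ω z * M.psi j ω z) P := (hψ j z).integrable_mul (hψ j z)
    have i5 : Integrable (fun ω => 2 * ∑ l, u l z * (M.psi j ω z * c j l ω)) P :=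
      (integrable_finsetSum _ fun l _ => i1 l).const_mul 2
    have i6 : Integrable (fun ω => M.psi j ω z * M.psi j ω z
        - 2 * ∑ l, u l z * (M.psi j ω z * c j l ω)) P := i4.sub i5
    simp_rw [h1]
    rw [integral_add i6 i3, integral_sub i4 i5, integral_const_mul,
      integral_finsetSum _ fun l _ => i1 l,
      integral_finsetSum _ fun l _ => integrable_finsetSum _ fun m _ => i2 l m]
    simp_rw [integral_finsetSum _ fun m _ => i2 _ m, integral_const_mul]
  -- The averaged residual is K(z,z) − 2∑λₗuₗ(z)² + ∑λₗuₗ(z)², which is zero by Mercer. Since every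
  -- residual is nonnegative, each one vanishes separately.
  have hsum : (p : ℝ)⁻¹ * ∑ j : Fin p, ∫ ω, (M.psi j ω z - ∑ l, c j l ω * u l z) ^ 2 ∂P = 0 := by
    have e1 : (p : ℝ)⁻¹ * ∑ j : Fin p, ∑ l, u l z * ∫ ω, M.psi j ω z * c j l ω ∂P
        = ∑ l, lam l * (u l z * u l z) := by
      rw [Finset.sum_comm, Finset.mul_sum]
      refine Finset.sum_congr rfl fun l _ => ?_
      rw [← Finset.mul_sum, mul_left_comm, hψc]
      ring
    have e2 : (p : ℝ)⁻¹ * ∑ j : Fin p, ∑ l, ∑ m, u l z * u m z * ∫ ω, c j m ω * c j l ω ∂P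
        = ∑ l, lam l * (u l z * u l z) := by
      rw [Finset.sum_comm, Finset.mul_sum]
      refine Finset.sum_congr rfl fun l _ => ?_
      rw [Finset.sum_comm, Finset.mul_sum]
      have e0 : ∀ m, (p : ℝ)⁻¹ * ∑ j : Fin p, u l z * u m z * ∫ ω, c j m ω * c j l ω ∂P
          = if l = m then lam m * (u l z * u m z) else 0 := by
        intro m
        rw [← Finset.mul_sum, mul_left_comm, hcc, mul_ite, mul_zero, mul_comm]
      simp_rw [e0]
      simp
    simp_rw [hDsq]
    rw [Finset.sum_add_distrib, Finset.sum_sub_distrib, ← Finset.mul_sum, mul_add, mul_sub,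
      mul_left_comm (p : ℝ)⁻¹ 2, e1, e2]
    have e3 : (p : ℝ)⁻¹ * ∑ j : Fin p, ∫ ω, M.psi j ω z * M.psi j ω z ∂P
        = ∑ l, lam l * (u l z * u l z) := h.kernel_eq_sum hK z z
    rw [e3]
    ring
  have hsum0 : ∀ j : Fin p, ∫ ω, (M.psi j ω z - ∑ l, c j l ω * u l z) ^ 2 ∂P = 0 := by
    intro j
    have h1 := (mul_eq_zero.1 hsum).resolve_left hp0.ne'
    exact (Finset.sum_eq_zero_iff_of_nonneg fun j _ => integral_nonneg fun ω => sq_nonneg _).1 h1 j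
      (Finset.mem_univ j)
  rw [ae_all_iff]
  intro j
  have h1 := (integral_eq_zero_iff_of_nonneg (fun ω => sq_nonneg _) (hD j).integrable_sq).1 (hsum0 j)
  filter_upwards [h1] with ω hω
  exact sub_eq_zero.1 (pow_eq_zero_iff two_ne_zero |>.1 hω)

end KarhunenLoeve

end LatentMetricModel

/-! ### General moment and tail estimates -/

section Probability

variable {Ω : Type*} [MeasurableSpace Ω] {P : Measure Ω} [IsProbabilityMeasure P]

/-- Integrals over independent random elements can be computed one after the other. -/
lemma ProbabilityTheory.IndepFun.lintegral_eq_lintegral_lintegral {α β : Type*} [MeasurableSpace α]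
    [MeasurableSpace β] {X : Ω → α} {Y : Ω → β} (h : IndepFun X Y P) (hX : Measurable X)
    (hY : Measurable Y) {F : α × β → ENNReal} (hF : Measurable F) :
    ∫⁻ ω, F (X ω, Y ω) ∂P = ∫⁻ ω, ∫⁻ ω', F (X ω, Y ω') ∂P ∂P := by
  have hYm := Measure.isProbabilityMeasure_map (μ := P) hY.aemeasurable
  rw [← lintegral_map hF (hX.prodMk hY), h.map_prod_eq_prod_map_map hX.aemeasurable hY.aemeasurable,
    lintegral_prod _ hF.aemeasurable, lintegral_map hF.lintegral_prod_right' hX]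
  refine lintegral_congr fun ω => ?_
  exact lintegral_map (hF.comp measurable_prodMk_left) hY

lemma lintegral_ofReal_le_of_integral_le {f : Ω → ℝ} (hf : Integrable f P) (h0 : ∀ ω, 0 ≤ f ω)
    {c : ℝ} (h : ∫ ω, f ω ∂P ≤ c) : ∫⁻ ω, ENNReal.ofReal (f ω) ∂P ≤ ENNReal.ofReal c := by
  rw [← ofReal_integral_eq_lintegral_ofReal hf (ae_of_all _ h0)]
  exact ENNReal.ofReal_le_ofReal h

/-- Second moment of an affine combination of centered orthogonal variables. -/
lemma integral_sq_const_add_sum {m : ℕ} {f : Fin m → Ω → ℝ} {v : ℝ}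
    (hf : ∀ i, MemLp (f i) 2 P) (hmean : ∀ i, ∫ ω, f i ω ∂P = 0)
    (horth : ∀ i j, ∫ ω, f i ω * f j ω ∂P = if i = j then v else 0) (a : ℝ) (c : Fin m → ℝ) :
    ∫ ω, (a + ∑ i, c i * f i ω) ^ 2 ∂P = a ^ 2 + v * ∑ i, c i ^ 2 := by
  have h1 : ∀ ω, (a + ∑ i, c i * f i ω) ^ 2 =
      a ^ 2 + ∑ i, 2 * a * c i * f i ω + ∑ i, ∑ j, c i * c j * (f i ω * f j ω) := by
    intro ω
    have h2 : ∑ i, ∑ j, c i * c j * (f i ω * f j ω) = (∑ i, c i * f i ω) ^ 2 := by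
      rw [sq, Finset.sum_mul_sum]
      exact Finset.sum_congr rfl fun l _ => Finset.sum_congr rfl fun m _ => by ring
    have h3 : ∑ i, 2 * a * c i * f i ω = 2 * a * ∑ i, c i * f i ω := by
      rw [Finset.mul_sum]
      exact Finset.sum_congr rfl fun l _ => by ring
    rw [h2, h3]
    ring
  have i1 : ∀ i, Integrable (fun ω => 2 * a * c i * f i ω) P := fun i =>
    ((hf i).integrable one_le_two).const_mul _
  have i2 : ∀ i j, Integrable (fun ω => c i * c j * (f i ω * f j ω)) P := fun i j =>
    ((hf i).integrable_mul (hf j)).const_mul _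
  have i3 : Integrable (fun ω => a ^ 2 + ∑ i, 2 * a * c i * f i ω) P :=
    (integrable_const _).add (integrable_finsetSum _ fun i _ => i1 i)
  simp_rw [h1]
  rw [integral_add i3 (integrable_finsetSum _ fun i _ => integrable_finsetSum _ fun j _ => i2 i j),
    integral_add (integrable_const _) (integrable_finsetSum _ fun i _ => i1 i),
    integral_finsetSum _ fun i _ => i1 i,
    integral_finsetSum _ fun i _ => integrable_finsetSum _ fun j _ => i2 i j]
  simp_rw [integral_finsetSum _ fun j _ => i2 _ j, integral_const_mul, hmean, horth]
  simp [Finset.mul_sum, mul_comm, sq]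

lemma integrable_sq_const_add_sum {m : ℕ} {f : Fin m → Ω → ℝ} (hf : ∀ i, MemLp (f i) 2 P)
    (a : ℝ) (c : Fin m → ℝ) : Integrable (fun ω => (a + ∑ i, c i * f i ω) ^ 2) P :=
  ((memLp_const a).add (memLp_finsetSum _ fun i _ => (hf i).const_mul (c i))).integrable_sq

/-- Variance of an average of independent variables. -/
lemma integral_sq_average_sub {p : ℕ} {Y : Fin p → Ω → ℝ} (hY : ∀ j, MemLp (Y j) 2 P)
    (hind : Pairwise fun j k => IndepFun (Y j) (Y k) P) :
    ∫ ω, ((p : ℝ)⁻¹ * ∑ j, Y j ω - (p : ℝ)⁻¹ * ∑ j, ∫ ω', Y j ω' ∂P) ^ 2 ∂P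
      = (p : ℝ)⁻¹ * ((p : ℝ)⁻¹ * ∑ j, Var[Y j; P]) := by
  have hs : MemLp (∑ j, Y j) 2 P := memLp_finsetSum' _ fun j _ => hY j
  have h1 := IndepFun.variance_sum (s := Finset.univ) (fun j _ => hY j) fun j _ k _ hjk => hind hjk
  have h2 : ∫ ω, (∑ j, Y j ω - ∑ j, ∫ ω', Y j ω' ∂P) ^ 2 ∂P = ∑ j, Var[Y j; P] := by
    rw [← h1, variance_eq_integral hs.aemeasurable]
    simp only [Finset.sum_apply]
    rw [integral_finsetSum _ fun j _ => (hY j).integrable one_le_two]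
  simp_rw [← mul_sub, mul_pow]
  rw [integral_const_mul, h2]
  ring

lemma integral_sq_mul_le {f g : Ω → ℝ} (hf : MemLp f 4 P) (hg : MemLp g 4 P) :
    MemLp (fun ω => f ω * g ω) 2 P ∧
    ∫ ω, (f ω * g ω) ^ 2 ∂P ≤ (∫ ω, |f ω| ^ 4 ∂P + ∫ ω, |g ω| ^ 4 ∂P) / 2 := by
  have : ENNReal.HolderTriple 4 4 2 := ⟨by
    rw [← two_mul, show (4 : ENNReal) = 2 * 2 by norm_num,
      ENNReal.mul_inv (by simp) (by simp), ← mul_assoc, ENNReal.mul_inv_cancel (by simp) (by simp),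
      one_mul]⟩
  have hfg : MemLp (fun ω => f ω * g ω) 2 P := hg.mul' hf
  have i1 : Integrable (fun ω => |f ω| ^ 4) P := by
    simpa using hf.integrable_norm_pow (p := 4) (by norm_num)
  have i2 : Integrable (fun ω => |g ω| ^ 4) P := by
    simpa using hg.integrable_norm_pow (p := 4) (by norm_num)
  refine ⟨hfg, ?_⟩
  rw [← integral_add i1 i2, ← integral_div]
  refine integral_mono hfg.integrable_sq ((i1.add i2).div_const 2) fun ω => ?_
  have h1 : |f ω| ^ 4 = (f ω ^ 2) ^ 2 := by rw [← sq_abs (f ω)]; ring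
  have h2 : |g ω| ^ 4 = (g ω ^ 2) ^ 2 := by rw [← sq_abs (g ω)]; ring
  simp only [h1, h2]
  nlinarith [sq_nonneg (f ω ^ 2 - g ω ^ 2)]

lemma variance_le_integral_sq {f : Ω → ℝ} (hf : MemLp f 2 P) : Var[f; P] ≤ ∫ ω, f ω ^ 2 ∂P := by
  rw [variance_eq_sub hf]
  simpa using sq_nonneg (∫ ω, f ω ∂P)

/-- Markov's inequality in a form that remains valid for a vanishing bound. -/
lemma measure_lt_le_of_lintegral_le {f : Ω → ENNReal} (hf : Measurable f) {D t : ℝ} (ht : 0 ≤ t)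
    (h : ∫⁻ ω, f ω ∂P ≤ ENNReal.ofReal (t * D)) :
    P.real {ω | ENNReal.ofReal D < f ω} ≤ t := by
  refine ENNReal.toReal_le_of_le_ofReal ht ?_
  -- If the bound is zero, `f` vanishes almost everywhere and the event is null; otherwise `D` is
  -- positive and can be divided out.
  rcases le_or_gt (t * D) 0 with hD | hD
  · rw [ENNReal.ofReal_of_nonpos hD] at h
    have h0 := (lintegral_eq_zero_iff hf).1 (le_antisymm h zero_le)
    have : P {ω | ENNReal.ofReal D < f ω} = 0 :=
      measure_mono_null (fun ω hω => (zero_le.trans_lt hω).ne') (ae_iff.1 h0)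
    rw [this]
    exact zero_le
  · have hD' : 0 < D := pos_of_mul_pos_right hD ht
    have h1 := (mul_meas_ge_le_lintegral hf (ENNReal.ofReal D)).trans h
    rw [mul_comm t, ENNReal.ofReal_mul hD'.le] at h1
    have h2 := (ENNReal.mul_le_mul_iff_right (by simpa using hD') ENNReal.ofReal_ne_top).1 h1
    exact (measure_mono (Set.ofPred_subset_ofPred.2 fun ω hω => le_of_lt hω)).trans h2

end Probability

/-! ### Moments of the features and of the noise -/

namespace LatentMetricModel

variable {Ω Ξ 𝒵 : Type*} [MeasurableSpace Ω] [MeasurableSpace Ξ]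
  [MetricSpace 𝒵] [CompactSpace 𝒵] [MeasurableSpace 𝒵] [BorelSpace 𝒵] {P : Measure Ω}
  [IsProbabilityMeasure P] {μ : Measure 𝒵} [IsProbabilityMeasure μ]
  {M : LatentMetricModel Ω Ξ 𝒵 P μ}

lemma integral_noise_mul (M : LatentMetricModel Ω Ξ 𝒵 P μ) (i j i' j' : ℕ) :
    ∫ ω, M.E i j ω * M.E i' j' ω ∂P = if i = i' ∧ j = j' then 1 else 0 := by
  split_ifs with h
  · obtain ⟨rfl, rfl⟩ := h
    rw [← M.var_E i j]
    simp_rw [sq]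
  · have hne : (i, j) ≠ (i', j') := fun h' => h (Prod.mk.inj h')
    have h1 := (M.iIndepFun_E.indepFun hne).integral_fun_mul_eq_mul_integral
      (M.measurable_E i j).aestronglyMeasurable (M.measurable_E i' j').aestronglyMeasurable
    rw [h1, M.mean_E, zero_mul]

lemma integral_eps_mul (M : LatentMetricModel Ω Ξ 𝒵 P μ) (i i' : ℕ) :
    ∫ ω, M.ε i ω * M.ε i' ω ∂P = if i = i' then M.σy ^ 2 else 0 := by
  split_ifs with h
  · subst h
    rw [← M.var_ε i]
    simp_rw [sq]
  · have h1 := (M.iIndepFun_ε.indepFun h).integral_fun_mul_eq_mul_integral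
      (M.measurable_ε i).aestronglyMeasurable (M.measurable_ε i').aestronglyMeasurable
    rw [h1, M.mean_ε, zero_mul]

lemma integral_sq_const_add_sum_eps (M : LatentMetricModel Ω Ξ 𝒵 P μ) {n : ℕ} (a : ℝ)
    (c : Fin n → ℝ) :
    ∫ ω, (a + ∑ i, c i * M.ε i ω) ^ 2 ∂P = a ^ 2 + M.σy ^ 2 * ∑ i, c i ^ 2 :=
  integral_sq_const_add_sum (f := fun i : Fin n => M.ε i) (fun i => M.memLp_ε i)
    (fun i => M.mean_ε i) (fun i j => by rw [M.integral_eps_mul]; simp [Fin.ext_iff]) a c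

lemma lintegral_sq_sum_noise (M : LatentMetricModel Ω Ξ 𝒵 P μ) {p : ℕ} (i : ℕ) (c : Fin p → ℝ) :
    ∫⁻ ω, ENNReal.ofReal ((∑ j : Fin p, c j * M.E i j ω) ^ 2) ∂P
      = ENNReal.ofReal (∑ j, c j ^ 2) := by
  have hE : ∀ j : Fin p, MemLp (M.E i j) 2 P := fun j => M.memLp_E i j
  have h := integral_sq_const_add_sum (v := 1) (f := fun j : Fin p => M.E i j) hE
    (fun j => M.mean_E i j) (fun j k => by rw [M.integral_noise_mul]; simp [Fin.ext_iff]) 0 c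
  have h' := integrable_sq_const_add_sum hE 0 c
  simp only [zero_add, one_mul, ne_eq, OfNat.ofNat_ne_zero, not_false_eq_true, zero_pow] at h h'
  rw [← ofReal_integral_eq_lintegral_ofReal h' (ae_of_all _ fun ω => sq_nonneg _), h]

/-- This makes the supremum defining `v₁` a bounded one; an unbounded real `⨆` would default to zero
and dominate nothing. -/
lemma Regular.variance_psi_mul_le (hM : M.Regular) : ∃ C, ∀ j z z',
    Var[fun ω => M.psi j ω z * M.psi j ω z'; P] ≤ C := by
  obtain ⟨C, hC⟩ := hM.fourth_psi
  refine ⟨C, fun j z z' => ?_⟩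
  obtain ⟨h1, h2⟩ := integral_sq_mul_le (hC j z).1 (hC j z').1
  refine (variance_le_integral_sq h1).trans (h2.trans ?_)
  linarith [(hC j z).2, (hC j z').2]

lemma Regular.average_variance_le_v₁ (hM : M.Regular) {p : ℕ} (hp : 1 ≤ p) (z z' : 𝒵) :
    (p : ℝ)⁻¹ * ∑ j : Fin p, Var[fun ω => M.psi j ω z * M.psi j ω z'; P] ≤ M.v₁ p := by
  obtain ⟨C, hC⟩ := hM.variance_psi_mul_le
  refine le_ciSup (f := fun w : 𝒵 × 𝒵 => (p : ℝ)⁻¹ *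
    ∑ j : Fin p, Var[fun ω => M.psi j ω w.1 * M.psi j ω w.2; P]) ⟨C, ?_⟩ (z, z')
  rintro _ ⟨w, rfl⟩
  have hp0 : (0 : ℝ) < p := by exact_mod_cast hp
  simp only
  rw [inv_mul_le_iff₀ hp0]
  refine (Finset.sum_le_sum fun (j : Fin p) _ => hC j w.1 w.2).trans (le_of_eq ?_)
  simp

lemma Regular.sum_integral_sq_le_v₂ (hM : M.Regular) {p : ℕ} (hp : 1 ≤ p) (z : 𝒵) :
    ∑ j : Fin p, ∫ ω, M.psi j ω z ^ 2 ∂P ≤ p * M.v₂ p := by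
  have hp0 : (0 : ℝ) < p := by exact_mod_cast hp
  obtain ⟨C, hC⟩ := exists_forall_abs_le_of_continuous
    ((hM.continuous_implicitKernel p).comp (continuous_id.prodMk continuous_id))
  rw [← inv_mul_le_iff₀ hp0]
  have h := le_ciSup (f := fun z : 𝒵 => (p : ℝ)⁻¹ * ∑ j : Fin p, ∫ ω, |M.psi j ω z| ^ 2 ∂P)
    ⟨C, ?_⟩ z
  · simp_rw [sq_abs] at h
    unfold v₂
    simp_rw [sq_abs]
    exact h
  · rintro _ ⟨w, rfl⟩
    have := (le_abs_self _).trans (hC w)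
    simp_rw [sq_abs, sq]
    exact this

lemma Regular.fourth_le_v₃ (hM : M.Regular) (i j : ℕ) : ∫ ω, |M.E i j ω| ^ 4 ∂P ≤ M.v₃ := by
  obtain ⟨C, hC⟩ := hM.fourth_E
  refine le_ciSup (f := fun ij : ℕ × ℕ => ∫ ω, |M.E ij.1 ij.2 ω| ^ 4 ∂P) ⟨C, ?_⟩ (i, j)
  rintro _ ⟨w, rfl⟩
  exact (hC w.1 w.2).2

lemma v₁_nonneg (M : LatentMetricModel Ω Ξ 𝒵 P μ) (p : ℕ) : 0 ≤ M.v₁ p :=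
  Real.iSup_nonneg fun _ => mul_nonneg (by positivity)
    (Finset.sum_nonneg fun _ _ => variance_nonneg _ _)

lemma v₂_nonneg (M : LatentMetricModel Ω Ξ 𝒵 P μ) (p : ℕ) : 0 ≤ M.v₂ p :=
  Real.iSup_nonneg fun _ => mul_nonneg (by positivity)
    (Finset.sum_nonneg fun _ _ => integral_nonneg fun _ => by positivity)

lemma v₃_nonneg (M : LatentMetricModel Ω Ξ 𝒵 P μ) : 0 ≤ M.v₃ :=
  Real.iSup_nonneg fun _ => integral_nonneg fun _ => by positivity

/-- The deviation of the empirical second moment of the features from the implicit kernel. -/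
noncomputable def kernelDeviation (M : LatentMetricModel Ω Ξ 𝒵 P μ) (p : ℕ) (z z' : 𝒵) (ω : Ω) :
    ℝ :=
  (p : ℝ)⁻¹ * ∑ j : Fin p, M.psi j ω z * M.psi j ω z' - M.implicitKernel p z z'

lemma Regular.memLp_psi_mul (hM : M.Regular) (j : ℕ) (z z' : 𝒵) :
    MemLp (fun ω => M.psi j ω z * M.psi j ω z') 2 P := by
  obtain ⟨C, hC⟩ := hM.fourth_psi
  exact (integral_sq_mul_le (hC j z).1 (hC j z').1).1

/-- At fixed points the products ψ_j(z)ψ_j(z') are independent in j, so averaging divides their mean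
variance by p. -/
lemma Regular.lintegral_sq_kernelDeviation_le (hM : M.Regular) {p : ℕ} (hp : 1 ≤ p) (z z' : 𝒵) :
    ∫⁻ ω, ENNReal.ofReal (M.kernelDeviation p z z' ω ^ 2) ∂P ≤ ENNReal.ofReal (M.v₁ p / p) := by
  have hY : ∀ j : Fin p, MemLp (fun ω => M.psi j ω z * M.psi j ω z') 2 P :=
    fun j => hM.memLp_psi_mul j z z'
  refine lintegral_ofReal_le_of_integral_le ?_ (fun ω => sq_nonneg _) ?_
  · exact (((memLp_finsetSum _ fun j _ => hY j).const_mul _).sub (memLp_const _)).integrable_sq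
  · have hind : Pairwise fun j k : Fin p => IndepFun (fun ω => M.psi j ω z * M.psi j ω z')
        (fun ω => M.psi k ω z * M.psi k ω z') P := by
      intro j k hjk
      have hm : Measurable fun f : 𝒵 → ℝ => f z * f z' :=
        (measurable_pi_apply z).mul (measurable_pi_apply z')
      exact (hM.iIndepFun_psi.indepFun (fun h => hjk (Fin.ext h))).comp hm hm
    have h := integral_sq_average_sub hY hind
    simp only [kernelDeviation, implicitKernel]
    rw [h, div_eq_inv_mul]
    exact mul_le_mul_of_nonneg_left (hM.average_variance_le_v₁ hp z z') (by positivity)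

/-- For fixed rows, products from different columns involve disjoint noise entries and are therefore
independent, also when the two rows coincide; each variance is at most a fourth moment. -/
lemma Regular.lintegral_sq_noise_deviation_le (hM : M.Regular) {p : ℕ} (hp : 1 ≤ p) (i i' : ℕ) :
    ∫⁻ ω, ENNReal.ofReal (((p : ℝ)⁻¹ * ∑ j : Fin p, M.E i j ω * M.E i' j ω
      - if i = i' then 1 else 0) ^ 2) ∂P ≤ ENNReal.ofReal (M.v₃ / p) := by
  have hp0 : (0 : ℝ) < p := by exact_mod_cast hp
  obtain ⟨C, hC⟩ := hM.fourth_E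
  have hY : ∀ j : Fin p, MemLp (fun ω => M.E i j ω * M.E i' j ω) 2 P :=
    fun j => (integral_sq_mul_le (hC i j).1 (hC i' j).1).1
  refine lintegral_ofReal_le_of_integral_le ?_ (fun ω => sq_nonneg _) ?_
  · exact (((memLp_finsetSum _ fun j _ => hY j).const_mul _).sub (memLp_const _)).integrable_sq
  · have hind : Pairwise fun j k : Fin p => IndepFun (fun ω => M.E i j ω * M.E i' j ω)
        (fun ω => M.E i k ω * M.E i' k ω) P := by
      intro j k hjk
      have hjk' : (j : ℕ) ≠ k := fun h => hjk (Fin.ext h)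
      exact M.iIndepFun_E.indepFun_mul_mul (fun ij => M.measurable_E ij.1 ij.2)
        (i, j) (i', j) (i, k) (i', k) (by simp [hjk']) (by simp [hjk']) (by simp [hjk'])
        (by simp [hjk'])
    have h := integral_sq_average_sub hY hind
    have hmean : (p : ℝ)⁻¹ * ∑ j : Fin p, ∫ ω, M.E i j ω * M.E i' j ω ∂P
        = if i = i' then 1 else 0 := by
      simp_rw [M.integral_noise_mul]
      by_cases hi : i = i' <;> simp [hi, hp0.ne']
    rw [hmean] at h
    rw [h, div_eq_inv_mul]
    refine mul_le_mul_of_nonneg_left ?_ (by positivity)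
    rw [inv_mul_le_iff₀ hp0]
    calc _ ≤ ∑ j : Fin p, M.v₃ := Finset.sum_le_sum fun j _ => by
          refine (variance_le_integral_sq (hY j)).trans
            ((integral_sq_mul_le (hC i j).1 (hC i' j).1).2.trans ?_)
          linarith [hM.fourth_le_v₃ i j, hM.fourth_le_v₃ i' j]
      _ = p * M.v₃ := by simp

/-! ### Moments at points that are functions of the latent sample -/

section RandomPoints

variable {h h' : (ℕ → 𝒵) → 𝒵}

lemma measurable_latent (M : LatentMetricModel Ω Ξ 𝒵 P μ) : Measurable fun ω i => M.z i ω :=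
  measurable_pi_lambda _ fun i => M.measurable_z i

lemma measurable_psi_random (M : LatentMetricModel Ω Ξ 𝒵 P μ) (j : ℕ) (hh : Measurable h) :
    Measurable fun ω => M.psi j ω (h fun i => M.z i ω) :=
  (M.measurable_uncurry_psi j).comp (measurable_id.prodMk (hh.comp M.measurable_latent))

lemma measurable_uncurry_ψ_apply (M : LatentMetricModel Ω Ξ 𝒵 P μ) (j : ℕ) (hh : Measurable h) :
    Measurable fun q : (ℕ → 𝒵) × Ξ => M.ψ j q.2 (h q.1) :=
  (M.measurable_ψ j).comp (measurable_snd.prodMk (hh.comp measurable_fst))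

/-- Moments of the random functions at random points of the latent sample. -/
lemma Regular.lintegral_sq_kernelDeviation_random_le (hM : M.Regular) {p : ℕ} (hp : 1 ≤ p)
    (hh : Measurable h) (hh' : Measurable h') :
    ∫⁻ ω, ENNReal.ofReal (M.kernelDeviation p (h fun i => M.z i ω) (h' fun i => M.z i ω) ω ^ 2) ∂P
      ≤ ENNReal.ofReal (M.v₁ p / p) := by
  let F : (ℕ → 𝒵) × Ξ → ENNReal := fun q => ENNReal.ofReal (((p : ℝ)⁻¹ * ∑ j : Fin p,
    M.ψ j q.2 (h q.1) * M.ψ j q.2 (h' q.1) - M.implicitKernel p (h q.1) (h' q.1)) ^ 2)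
  have hFm : Measurable F := by
    have h1 := fun j : Fin p => M.measurable_uncurry_ψ_apply (P := P) j hh
    have h2 := fun j : Fin p => M.measurable_uncurry_ψ_apply (P := P) j hh'
    have h3 : Measurable fun q : (ℕ → 𝒵) × Ξ => M.implicitKernel p (h q.1) (h' q.1) :=
      (hM.continuous_implicitKernel p).measurable.comp
        ((hh.comp measurable_fst).prodMk (hh'.comp measurable_fst))
    exact ((((Finset.measurable_fun_sum _ fun (j : Fin p) _ => (h1 j).mul (h2 j)).const_mul _).sub
      h3).pow_const 2).ennreal_ofReal
  have h1 := IndepFun.lintegral_eq_lintegral_lintegral M.indep_z_ξ M.measurable_latent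
    M.measurable_ξ hFm
  refine (le_of_eq h1).trans ?_
  calc _ ≤ ∫⁻ _, ENNReal.ofReal (M.v₁ p / p) ∂P := lintegral_mono fun ω =>
        hM.lintegral_sq_kernelDeviation_le hp (h fun i => M.z i ω) (h' fun i => M.z i ω)
    _ = _ := by simp

/-- A coordinate for `h` gives a sample point and a constant `h` gives a test point, so one
statement serves both. -/
lemma Regular.lintegral_sum_sq_psi_random_le (hM : M.Regular) {p : ℕ} (hp : 1 ≤ p)
    (hh : Measurable h) :
    ∫⁻ ω, ENNReal.ofReal (∑ j : Fin p, M.psi j ω (h fun i => M.z i ω) ^ 2) ∂P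
      ≤ ENNReal.ofReal (p * M.v₂ p) := by
  let F : (ℕ → 𝒵) × Ξ → ENNReal :=
    fun q => ENNReal.ofReal (∑ j : Fin p, M.ψ j q.2 (h q.1) ^ 2)
  have hFm : Measurable F := (Finset.measurable_fun_sum _ fun (j : Fin p) _ =>
    (M.measurable_uncurry_ψ_apply j hh).pow_const 2).ennreal_ofReal
  have h1 := IndepFun.lintegral_eq_lintegral_lintegral M.indep_z_ξ M.measurable_latent
    M.measurable_ξ hFm
  refine (le_of_eq h1).trans ?_
  calc _ ≤ ∫⁻ _, ENNReal.ofReal (p * M.v₂ p) ∂P := lintegral_mono fun ω => by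
        have hI : ∀ j : Fin p, Integrable (fun ω' => M.psi j ω' (h fun i => M.z i ω) ^ 2) P :=
          fun j => (hM.memLp_psi j _).integrable_sq
        refine lintegral_ofReal_le_of_integral_le (integrable_finsetSum _ fun j _ => hI j)
          (fun ω' => Finset.sum_nonneg fun j _ => sq_nonneg _) ?_
        rw [integral_finsetSum _ fun j _ => hI j]
        exact hM.sum_integral_sq_le_v₂ hp _
    _ = _ := by simp

/-- Given the latent points and `ξ`, the features are constants paired with orthonormal noise, and
the mean square is the sum of their squares. -/
lemma Regular.lintegral_sq_sum_psi_noise_random_le (hM : M.Regular) {p : ℕ} (hp : 1 ≤ p) (i : ℕ)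
    (hh : Measurable h) :
    ∫⁻ ω, ENNReal.ofReal ((∑ j : Fin p, M.psi j ω (h fun i => M.z i ω) * M.E i j ω) ^ 2) ∂P
      ≤ ENNReal.ofReal (p * M.v₂ p) := by
  let F : ((ℕ → 𝒵) × Ξ) × (ℕ × ℕ → ℝ) → ENNReal :=
    fun q => ENNReal.ofReal ((∑ j : Fin p, M.ψ j q.1.2 (h q.1.1) * q.2 (i, j)) ^ 2)
  have hFm : Measurable F := ((Finset.measurable_fun_sum _ fun (j : Fin p) _ =>
    ((M.measurable_uncurry_ψ_apply j hh).comp measurable_fst).mul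
      ((measurable_pi_apply (i, (j : ℕ))).comp measurable_snd)).pow_const 2).ennreal_ofReal
  have h1 := IndepFun.lintegral_eq_lintegral_lintegral M.indep_zξ_E
    (M.measurable_latent.prodMk M.measurable_ξ)
    (measurable_pi_lambda _ fun ij : ℕ × ℕ => M.measurable_E ij.1 ij.2) hFm
  refine (le_of_eq h1).trans ?_
  refine le_trans (le_of_eq (lintegral_congr fun ω => ?_)) (hM.lintegral_sum_sq_psi_random_le hp hh)
  exact M.lintegral_sq_sum_noise i fun j : Fin p => M.psi j ω (h fun i => M.z i ω)

end RandomPoints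

end LatentMetricModel

/-- The coefficient with k = r − 1 suffices: its head bounds the first r − 1 squares, and its tail
is a single coordinate, in which the eigenvalue cancels and leaves the last square. -/
lemma IsEigensystem.sum_sq_le_supBeta_mul {𝒵 : Type*} [TopologicalSpace 𝒵] [CompactSpace 𝒵]
    [MeasurableSpace 𝒵] {μ : Measure 𝒵} {κ : 𝒵 → 𝒵 → ℝ} {r : ℕ} {lam : Fin r → ℝ}
    {u : Fin r → 𝒵 → ℝ} (h : IsEigensystem μ κ lam u) (hu : ∀ l, Continuous (u l)) (z : 𝒵) :
    ∑ l, u l z ^ 2 ≤ supBeta lam u * r := by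
  rcases r with _ | m
  · simp
  have hle : betaCoeff lam u m ≤ supBeta lam u :=
    le_ciSup (f := fun k : Fin (m + 1) => betaCoeff lam u k) (Set.finite_range _).bddAbove
      (Fin.last m)
  have hc : Continuous fun z : 𝒵 => max ((∑ l : Fin (m + 1) with l.val < m, u l z ^ 2) / (m : ℝ))
    (max ((∑ l : Fin (m + 1) with m ≤ l.val, featureMap lam u z l ^ 2) /
        ∑ l : Fin (m + 1) with m ≤ l.val, lam l)
      ((∑ l : Fin (m + 1) with m ≤ l.val, lam l * featureMap lam u z l ^ 2) /
        ∑ l : Fin (m + 1) with m ≤ l.val, lam l ^ 2)) := by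
    simp only [featureMap]
    fun_prop
  obtain ⟨C, hC⟩ := exists_forall_abs_le_of_continuous hc
  have hz : _ ≤ betaCoeff lam u m := le_ciSup (f := fun z : 𝒵 => max
      ((∑ l : Fin (m + 1) with l.val < m, u l z ^ 2) / (m : ℝ))
      (max ((∑ l : Fin (m + 1) with m ≤ l.val, featureMap lam u z l ^ 2) /
        ∑ l : Fin (m + 1) with m ≤ l.val, lam l)
      ((∑ l : Fin (m + 1) with m ≤ l.val, lam l * featureMap lam u z l ^ 2) /
        ∑ l : Fin (m + 1) with m ≤ l.val, lam l ^ 2)))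
    ⟨C, by rintro _ ⟨w, rfl⟩; exact (le_abs_self _).trans (hC w)⟩ z
  have h1 := (le_max_left _ _).trans (hz.trans hle)
  have h2 := (le_max_left _ _).trans ((le_max_right _ _).trans (hz.trans hle))
  have hlast : (Finset.univ.filter fun l : Fin (m + 1) => m ≤ l.val) = {Fin.last m} := by
    ext l
    simp only [Finset.mem_filter, Finset.mem_univ, true_and, Finset.mem_singleton, Fin.ext_iff,
      Fin.val_last]
    omega
  rw [hlast, Finset.sum_singleton, Finset.sum_singleton, featureMap, mul_pow,
    Real.sq_sqrt (h.pos _).le, mul_div_cancel_left₀ _ (h.pos _).ne'] at h2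
  have h3 : ∑ l : Fin (m + 1) with l.val < m, u l z ^ 2 ≤ supBeta lam u * m := by
    rcases Nat.eq_zero_or_pos m with rfl | hm
    · simp
    · rwa [div_le_iff₀ (by exact_mod_cast hm)] at h1
  rw [← Finset.sum_filter_add_sum_filter_not Finset.univ fun l : Fin (m + 1) => l.val < m]
  simp only [not_lt]
  rw [hlast, Finset.sum_singleton]
  push_cast
  linarith

/-! ### Mean squares of sums -/

section SumsOfSquares

variable {Ω : Type*} [MeasurableSpace Ω] {P : Measure Ω}

lemma lintegral_sq_const_mul_le {f : Ω → ℝ} {B : ℝ} (k : ℝ)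
    (h : ∫⁻ ω, ENNReal.ofReal (f ω ^ 2) ∂P ≤ ENNReal.ofReal B) :
    ∫⁻ ω, ENNReal.ofReal ((k * f ω) ^ 2) ∂P ≤ ENNReal.ofReal (k ^ 2 * B) := by
  simp_rw [mul_pow, ENNReal.ofReal_mul (sq_nonneg k)]
  rw [lintegral_const_mul' _ _ ENNReal.ofReal_ne_top]
  gcongr

lemma lintegral_sq_add_add_add_le {a b c d : Ω → ℝ} (ha : Measurable a) (hb : Measurable b)
    (hc : Measurable c) {A B C D : ℝ} (hA : 0 ≤ A) (hB : 0 ≤ B) (hC : 0 ≤ C) (hD : 0 ≤ D)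
    (Ia : ∫⁻ ω, ENNReal.ofReal (a ω ^ 2) ∂P ≤ ENNReal.ofReal A)
    (Ib : ∫⁻ ω, ENNReal.ofReal (b ω ^ 2) ∂P ≤ ENNReal.ofReal B)
    (Ic : ∫⁻ ω, ENNReal.ofReal (c ω ^ 2) ∂P ≤ ENNReal.ofReal C)
    (Id : ∫⁻ ω, ENNReal.ofReal (d ω ^ 2) ∂P ≤ ENNReal.ofReal D) :
    ∫⁻ ω, ENNReal.ofReal ((a ω + b ω + c ω + d ω) ^ 2) ∂P ≤
      ENNReal.ofReal (4 * (A + B + C + D)) := by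
  have hpt : ∀ ω, ENNReal.ofReal ((a ω + b ω + c ω + d ω) ^ 2) ≤
      ENNReal.ofReal 4 * (ENNReal.ofReal (a ω ^ 2) + ENNReal.ofReal (b ω ^ 2)
        + ENNReal.ofReal (c ω ^ 2) + ENNReal.ofReal (d ω ^ 2)) := by
    intro ω
    rw [← ENNReal.ofReal_add (by positivity) (by positivity),
      ← ENNReal.ofReal_add (by positivity) (by positivity),
      ← ENNReal.ofReal_add (by positivity) (by positivity), ← ENNReal.ofReal_mul (by norm_num)]
    refine ENNReal.ofReal_le_ofReal ?_
    nlinarith [sq_nonneg (a ω - b ω), sq_nonneg (a ω - c ω), sq_nonneg (a ω - d ω),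
      sq_nonneg (b ω - c ω), sq_nonneg (b ω - d ω), sq_nonneg (c ω - d ω)]
  refine (lintegral_mono hpt).trans ?_
  rw [lintegral_const_mul' _ _ ENNReal.ofReal_ne_top, lintegral_add_left (by fun_prop),
    lintegral_add_left (by fun_prop), lintegral_add_left (by fun_prop),
    ENNReal.ofReal_mul (by norm_num), ENNReal.ofReal_add (by positivity) hD,
    ENNReal.ofReal_add (by positivity) hC, ENNReal.ofReal_add hA hB]
  gcongr

lemma sum_sum_ofReal_eq {m n : ℕ} {f : Fin m → Fin n → ℝ} (hf : ∀ i j, 0 ≤ f i j) :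
    ∑ i, ∑ j, ENNReal.ofReal (f i j) = ENNReal.ofReal (∑ i, ∑ j, f i j) := by
  rw [ENNReal.ofReal_sum_of_nonneg fun i _ => Finset.sum_nonneg fun j _ => hf i j]
  exact Finset.sum_congr rfl fun i _ => (ENNReal.ofReal_sum_of_nonneg fun j _ => hf i j).symm

end SumsOfSquares

namespace LatentMetricModel

variable {Ω Ξ 𝒵 : Type*} [MeasurableSpace Ω] [MeasurableSpace Ξ]
  [MetricSpace 𝒵] [CompactSpace 𝒵] [MeasurableSpace 𝒵] [BorelSpace 𝒵] {P : Measure Ω}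
  [IsProbabilityMeasure P] {μ : Measure 𝒵} [IsProbabilityMeasure μ]
  {M : LatentMetricModel Ω Ξ 𝒵 P μ}

/-! ### Concentration of the Gram matrix of the eigenfunctions -/

section Concentration

/-- Hoeffding's inequality: values in [−R, R] give sub-Gaussian parameter R². -/
lemma measure_sum_sub_ge_le (M : LatentMetricModel Ω Ξ 𝒵 P μ) {f : 𝒵 → ℝ} (hf : Measurable f)
    {R : ℝ} (hR : 0 ≤ R) (hfR : ∀ z, |f z| ≤ R) (n : ℕ) {t : ℝ} (ht : 0 ≤ t) :
    P.real {ω | t ≤ ∑ i ∈ Finset.range n, (f (M.z i ω) - ∫ z, f z ∂μ)} ≤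
      Real.exp (-t ^ 2 / (2 * n * R ^ 2)) := by
  have hc : (‖R - -R‖₊ / 2) ^ 2 = Real.toNNReal R ^ 2 := by
    congr 1
    ext
    simp [abs_of_nonneg hR, hR, ← two_mul]
  have hsub : ∀ i < n, HasSubgaussianMGF (fun ω => f (M.z i ω) - ∫ z, f z ∂μ)
      (Real.toNNReal R ^ 2) P := by
    intro i _
    have he := integral_map (M.measurable_z i).aemeasurable
      (hf.aestronglyMeasurable (μ := Measure.map (M.z i) P))
    rw [M.map_z i] at he
    rw [← hc, he]
    exact hasSubgaussianMGF_of_mem_Icc (hf.comp (M.measurable_z i)).aemeasurable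
      (ae_of_all _ fun ω => abs_le.1 (hfR _))
  have hind : iIndepFun (fun i ω => f (M.z i ω) - ∫ z, f z ∂μ) P :=
    M.iIndepFun_z.comp (fun _ z => f z - ∫ z, f z ∂μ) fun _ => hf.sub_const _
  have h := HasSubgaussianMGF.measure_sum_range_ge_le_of_iIndepFun hind hsub ht
  simpa [hR] using h

lemma measure_abs_sum_sub_ge_le (M : LatentMetricModel Ω Ξ 𝒵 P μ) {f : 𝒵 → ℝ} (hf : Measurable f)
    {R : ℝ} (hR : 0 ≤ R) (hfR : ∀ z, |f z| ≤ R) (n : ℕ) {t : ℝ} (ht : 0 ≤ t) :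
    P.real {ω | t ≤ |∑ i ∈ Finset.range n, (f (M.z i ω) - ∫ z, f z ∂μ)|} ≤
      2 * Real.exp (-t ^ 2 / (2 * n * R ^ 2)) := by
  have h1 := M.measure_sum_sub_ge_le hf hR hfR n ht
  have h2 := M.measure_sum_sub_ge_le hf.neg hR (fun z => by simpa using hfR z) n ht
  have hsub : {ω | t ≤ |∑ i ∈ Finset.range n, (f (M.z i ω) - ∫ z, f z ∂μ)|} ⊆
      {ω | t ≤ ∑ i ∈ Finset.range n, (f (M.z i ω) - ∫ z, f z ∂μ)} ∪
      {ω | t ≤ ∑ i ∈ Finset.range n, ((-f) (M.z i ω) - ∫ z, (-f) z ∂μ)} := by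
    intro ω hω
    have e : ∑ i ∈ Finset.range n, ((-f) (M.z i ω) - ∫ z, (-f) z ∂μ)
        = -∑ i ∈ Finset.range n, (f (M.z i ω) - ∫ z, f z ∂μ) := by
      rw [← Finset.sum_neg_distrib]
      refine Finset.sum_congr rfl fun i _ => ?_
      simp only [Pi.neg_apply, integral_neg]
      ring
    rw [Set.mem_union, Set.mem_ofPred_eq, Set.mem_ofPred_eq, e]
    exact le_abs.1 hω
  refine (measureReal_mono hsub).trans ((measureReal_union_le _ _).trans ?_)
  linarith

/-- The matrix of values of the eigenfunctions at the latent sample. -/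
def design (M : LatentMetricModel Ω Ξ 𝒵 P μ) (n : ℕ) {r : ℕ} (u : Fin r → 𝒵 → ℝ) (ω : Ω) :
    Matrix (Fin n) (Fin r) ℝ :=
  Matrix.of fun i l => u l (M.z i ω)

/-- Concentration of the Gram matrix of bounded orthonormal functions. -/
lemma measure_gram_deviation_le (M : LatentMetricModel Ω Ξ 𝒵 P μ) {r : ℕ} {u : Fin r → 𝒵 → ℝ}
    (hu : ∀ l, Continuous (u l)) (horth : ∀ l m, ∫ z, u l z * u m z ∂μ = if l = m then 1 else 0)
    {R : ℝ} (hR : ∀ z, ∑ l, u l z ^ 2 ≤ R) (n : ℕ) :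
    P.real {ω | ((n : ℝ) / 2) ^ 2 < ∑ l, ∑ m, ((M.design n u ω)ᵀ * M.design n u ω -
        (n : ℝ) • (1 : Matrix (Fin r) (Fin r) ℝ)) l m ^ 2} ≤
      2 * r ^ 2 * Real.exp (-((n : ℝ) / (8 * r ^ 2 * R ^ 2))) := by
  have hne : Nonempty 𝒵 := nonempty_of_isProbabilityMeasure μ
  have hR0 : 0 ≤ R := (Finset.sum_nonneg fun _ _ => sq_nonneg _).trans (hR hne.some)
  have hent : ∀ ω l m, ((M.design n u ω)ᵀ * M.design n u ω -
        (n : ℝ) • (1 : Matrix (Fin r) (Fin r) ℝ)) l m =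
      ∑ i ∈ Finset.range n, (u l (M.z i ω) * u m (M.z i ω) - ∫ z, u l z * u m z ∂μ) := by
    intro ω l m
    rw [Finset.sum_sub_distrib, ← Fin.sum_univ_eq_sum_range
      (fun i => u l (M.z i ω) * u m (M.z i ω)), horth]
    simp [Matrix.mul_apply, design, Matrix.one_apply]
  have hbd : ∀ l m z, |u l z * u m z| ≤ R := by
    intro l m z
    have h1 : u l z ^ 2 ≤ R :=
      (Finset.single_le_sum (fun l _ => sq_nonneg (u l z)) (Finset.mem_univ l)).trans (hR z)
    have h2 : u m z ^ 2 ≤ R :=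
      (Finset.single_le_sum (fun l _ => sq_nonneg (u l z)) (Finset.mem_univ m)).trans (hR z)
    rw [abs_le]
    constructor <;> nlinarith [sq_nonneg (u l z + u m z), sq_nonneg (u l z - u m z)]
  -- If all r² entries are below n/(2r), the sum of their squares is at most (n/2)². Hoeffding at
  -- the level n/(2r) gives the exponent n/(8r²R²).
  have hsub : {ω | ((n : ℝ) / 2) ^ 2 < ∑ l, ∑ m, ((M.design n u ω)ᵀ * M.design n u ω -
        (n : ℝ) • (1 : Matrix (Fin r) (Fin r) ℝ)) l m ^ 2} ⊆
      ⋃ l, ⋃ m, {ω | (n : ℝ) / (2 * r) ≤ |∑ i ∈ Finset.range n,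
        ((fun z => u l z * u m z) (M.z i ω) - ∫ z, u l z * u m z ∂μ)|} := by
    intro ω hω
    by_contra hcon
    simp only [Set.mem_iUnion, Set.mem_ofPred_eq, not_exists, not_le] at hcon
    rw [Set.mem_ofPred_eq] at hω
    refine absurd hω (not_lt.2 ?_)
    have h1 : ∀ l m, ((M.design n u ω)ᵀ * M.design n u ω -
        (n : ℝ) • (1 : Matrix (Fin r) (Fin r) ℝ)) l m ^ 2 ≤ ((n : ℝ) / (2 * r)) ^ 2 := by
      intro l m
      rw [hent, sq_le_sq]
      exact (hcon l m).le.trans (le_abs_self _)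
    refine (Finset.sum_le_sum fun l _ => Finset.sum_le_sum fun m _ => h1 l m).trans ?_
    simp only [Finset.sum_const, Finset.card_univ, Fintype.card_fin, nsmul_eq_mul]
    rcases Nat.eq_zero_or_pos r with rfl | hr
    · simp
      positivity
    · have hr' : (r : ℝ) ≠ 0 := by positivity
      refine le_of_eq ?_
      field_simp
  have hfin : ∀ l m, P.real {ω | (n : ℝ) / (2 * r) ≤ |∑ i ∈ Finset.range n,
        ((fun z => u l z * u m z) (M.z i ω) - ∫ z, u l z * u m z ∂μ)|} ≤
      2 * Real.exp (-((n : ℝ) / (8 * r ^ 2 * R ^ 2))) := by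
    intro l m
    refine (M.measure_abs_sum_sub_ge_le (f := fun z => u l z * u m z)
      ((hu l).mul (hu m)).measurable hR0 (hbd l m) n (by positivity)).trans (le_of_eq ?_)
    congr 2
    rcases Nat.eq_zero_or_pos n with rfl | hn
    · simp
    have hr' : (r : ℝ) ≠ 0 := by
      have := l.pos
      positivity
    -- For R = 0 both exponents are divisions by zero, hence zero.
    rcases hR0.eq_or_lt with hR' | hR'
    · simp [← hR']
    · field_simp
      ring
  calc _ ≤ _ := measureReal_mono hsub
    _ ≤ ∑ l : Fin r, ∑ m : Fin r, 2 * Real.exp (-((n : ℝ) / (8 * r ^ 2 * R ^ 2))) :=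
        (measureReal_iUnion_fintype_le _).trans (Finset.sum_le_sum fun l _ =>
          (measureReal_iUnion_fintype_le _).trans (Finset.sum_le_sum fun m _ => hfin l m))
    _ = _ := by simp; ring

end Concentration

/-! ### Fluctuation of the empirical covariance matrix -/

section Perturbation

/-- The difference between the empirical covariance matrix and its mean given the latent sample. -/
noncomputable def perturbation (M : LatentMetricModel Ω Ξ 𝒵 P μ) (n p : ℕ) (ω : Ω) :
    Matrix (Fin n) (Fin n) ℝ :=
  (p : ℝ)⁻¹ • (M.X n p ω * (M.X n p ω)ᵀ)
    - Matrix.of (fun i i' : Fin n => M.implicitKernel p (M.z i ω) (M.z i' ω)) - M.σx ^ 2 • 1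

/-- The split into signal, two cross terms and noise isolates pieces governed respectively by `v₁`,
`v₂`, `v₂` and `v₃`. -/
lemma perturbation_apply (M : LatentMetricModel Ω Ξ 𝒵 P μ) (n p : ℕ) (ω : Ω) (i i' : Fin n) :
    M.perturbation n p ω i i' = M.kernelDeviation p (M.z i ω) (M.z i' ω) ω
      + M.σx * ((p : ℝ)⁻¹ * ∑ j : Fin p, M.psi j ω (M.z i ω) * M.E i' j ω)
      + M.σx * ((p : ℝ)⁻¹ * ∑ j : Fin p, M.psi j ω (M.z i' ω) * M.E i j ω)
      + M.σx ^ 2 * ((p : ℝ)⁻¹ * ∑ j : Fin p, M.E i j ω * M.E i' j ω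
        - if (i : ℕ) = i' then 1 else 0) := by
  have h : ∑ j : Fin p, (M.psi j ω (M.z i ω) + M.σx * M.E i j ω) *
        (M.psi j ω (M.z i' ω) + M.σx * M.E i' j ω)
      = ∑ j : Fin p, M.psi j ω (M.z i ω) * M.psi j ω (M.z i' ω)
        + M.σx * ∑ j : Fin p, M.psi j ω (M.z i ω) * M.E i' j ω
        + M.σx * ∑ j : Fin p, M.psi j ω (M.z i' ω) * M.E i j ω
        + M.σx ^ 2 * ∑ j : Fin p, M.E i j ω * M.E i' j ω := by
    rw [Finset.mul_sum, Finset.mul_sum, Finset.mul_sum, ← Finset.sum_add_distrib,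
      ← Finset.sum_add_distrib, ← Finset.sum_add_distrib]
    exact Finset.sum_congr rfl fun j _ => by ring
  simp only [perturbation, Matrix.sub_apply, Matrix.smul_apply, Matrix.mul_apply,
    Matrix.transpose_apply, X, Matrix.of_apply, smul_eq_mul, Matrix.one_apply, kernelDeviation,
    Fin.ext_iff]
  rw [h]
  ring

lemma Regular.measurable_kernelDeviation_random (hM : M.Regular) (p i i' : ℕ) :
    Measurable fun ω => M.kernelDeviation p (M.z i ω) (M.z i' ω) ω := by
  have h1 : ∀ (j : Fin p) i, Measurable fun ω => M.psi j ω (M.z i ω) := fun j i =>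
    M.measurable_psi_random j (measurable_pi_apply i)
  have h2 : Measurable fun ω => M.implicitKernel p (M.z i ω) (M.z i' ω) :=
    (hM.continuous_implicitKernel p).measurable.comp ((M.measurable_z i).prodMk (M.measurable_z i'))
  exact ((Finset.measurable_fun_sum _ fun j _ => (h1 j i).mul (h1 j i')).const_mul _).sub h2

lemma measurable_sum_psi_mul_noise (M : LatentMetricModel Ω Ξ 𝒵 P μ) (p i i' : ℕ) :
    Measurable fun ω => ∑ j : Fin p, M.psi j ω (M.z i ω) * M.E i' j ω :=
  Finset.measurable_fun_sum _ fun (j : Fin p) _ =>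
    (M.measurable_psi_random j (measurable_pi_apply i)).mul (M.measurable_E i' j)

lemma measurable_sum_noise_mul_noise (M : LatentMetricModel Ω Ξ 𝒵 P μ) (p i i' : ℕ) :
    Measurable fun ω => ∑ j : Fin p, M.E i j ω * M.E i' j ω :=
  Finset.measurable_fun_sum _ fun (j : Fin p) _ => (M.measurable_E i j).mul (M.measurable_E i' j)

lemma Regular.measurable_perturbation (hM : M.Regular) (n p : ℕ) (i i' : Fin n) :
    Measurable fun ω => M.perturbation n p ω i i' := by
  simp_rw [perturbation_apply]
  exact (((hM.measurable_kernelDeviation_random p i i').add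
    (((M.measurable_sum_psi_mul_noise p i i').const_mul _).const_mul _)).add
    (((M.measurable_sum_psi_mul_noise p i' i).const_mul _).const_mul _)).add
    ((((M.measurable_sum_noise_mul_noise p i i').const_mul _).sub_const _).const_mul _)

/-- Cauchy-Schwarz over four pieces costs a factor 4, and the two equal cross terms turn it into 8.
-/
lemma Regular.lintegral_sq_perturbation_le (hM : M.Regular) {n p : ℕ} (hp : 1 ≤ p)
    (i i' : Fin n) :
    ∫⁻ ω, ENNReal.ofReal (M.perturbation n p ω i i' ^ 2) ∂P ≤
      ENNReal.ofReal (8 * (M.v₁ p + M.σx ^ 2 * M.v₂ p + M.σx ^ 4 * M.v₃) / p) := by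
  have hp0 : (0 : ℝ) < p := by exact_mod_cast hp
  have hv1 := M.v₁_nonneg p
  have hv2 := M.v₂_nonneg p
  have hv3 := M.v₃_nonneg
  have Ia : ∫⁻ ω, ENNReal.ofReal (M.kernelDeviation p (M.z i ω) (M.z i' ω) ω ^ 2) ∂P ≤
      ENNReal.ofReal (M.v₁ p / p) :=
    hM.lintegral_sq_kernelDeviation_random_le (h := fun f => f i) (h' := fun f => f i') hp
      (measurable_pi_apply (i : ℕ)) (measurable_pi_apply (i' : ℕ))
  have Ib : ∀ i i' : Fin n,
      ∫⁻ ω, ENNReal.ofReal ((∑ j : Fin p, M.psi j ω (M.z i ω) * M.E i' j ω) ^ 2) ∂P ≤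
        ENNReal.ofReal (p * M.v₂ p) := fun i i' =>
    hM.lintegral_sq_sum_psi_noise_random_le (h := fun f => f i) hp i'
      (measurable_pi_apply (i : ℕ))
  have Id := hM.lintegral_sq_noise_deviation_le hp i i'
  simp_rw [perturbation_apply, ← mul_assoc M.σx]
  refine (lintegral_sq_add_add_add_le (hM.measurable_kernelDeviation_random p i i')
    ((M.measurable_sum_psi_mul_noise p i i').const_mul _)
    ((M.measurable_sum_psi_mul_noise p i' i).const_mul _) (by positivity) (by positivity)
    (by positivity) (by positivity) Ia (lintegral_sq_const_mul_le _ (Ib i i'))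
    (lintegral_sq_const_mul_le _ (Ib i' i)) (lintegral_sq_const_mul_le _ Id)).trans ?_
  refine ENNReal.ofReal_le_ofReal ?_
  have e : 4 * (M.v₁ p / p + (M.σx * (p : ℝ)⁻¹) ^ 2 * (p * M.v₂ p)
      + (M.σx * (p : ℝ)⁻¹) ^ 2 * (p * M.v₂ p) + (M.σx ^ 2) ^ 2 * (M.v₃ / p))
      = (4 * M.v₁ p + 8 * (M.σx ^ 2 * M.v₂ p) + 4 * (M.σx ^ 4 * M.v₃)) / p := by
    field_simp
    ring
  rw [e]
  gcongr
  have : 0 ≤ M.σx ^ 4 * M.v₃ := by positivity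
  linarith

/-- The perturbation is small with high probability. -/
lemma Regular.measure_perturbation_le (hM : M.Regular) (n : ℕ) {p : ℕ} (hp : 1 ≤ p) {s : ℝ}
    (hs : 0 < s) :
    P.real {ω | (s / 2) ^ 2 < ∑ i, ∑ i', M.perturbation n p ω i i' ^ 2} ≤
      32 * ((n : ℝ) ^ 2 / p * ((M.v₁ p + M.σx ^ 2 * M.v₂ p + M.σx ^ 4 * M.v₃) / s ^ 2)) := by
  have hv1 := M.v₁_nonneg p
  have hv2 := M.v₂_nonneg p
  have hv3 := M.v₃_nonneg
  have hmeas : ∀ i i', Measurable fun ω => ENNReal.ofReal (M.perturbation n p ω i i' ^ 2) :=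
    fun i i' => ((hM.measurable_perturbation n p i i').pow_const 2).ennreal_ofReal
  have hset : {ω | (s / 2) ^ 2 < ∑ i, ∑ i', M.perturbation n p ω i i' ^ 2} ⊆
      {ω | ENNReal.ofReal ((s / 2) ^ 2) <
        ∑ i, ∑ i', ENNReal.ofReal (M.perturbation n p ω i i' ^ 2)} := by
    intro ω hω
    have e := sum_sum_ofReal_eq fun i i' => sq_nonneg (M.perturbation n p ω i i')
    rw [Set.mem_ofPred_eq, e]
    exact (ENNReal.ofReal_lt_ofReal_iff_of_nonneg (by positivity)).2 hω
  -- The factor 32 is the 8 of the entrywise bound times the 4 from (s/2)²; n² counts the entries.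
  refine (measureReal_mono hset).trans (measure_lt_le_of_lintegral_le ?_ (by positivity) ?_)
  · exact Finset.measurable_fun_sum _ fun i _ => Finset.measurable_fun_sum _ fun i' _ => hmeas i i'
  · rw [lintegral_finsetSum _ fun i _ => Finset.measurable_fun_sum _ fun i' _ => hmeas i i']
    simp_rw [lintegral_finsetSum _ fun i' _ => hmeas _ i']
    refine (Finset.sum_le_sum fun i _ => Finset.sum_le_sum fun i' _ =>
      hM.lintegral_sq_perturbation_le hp i i').trans (le_of_eq ?_)
    simp only [Finset.sum_const, Finset.card_univ, Fintype.card_fin, nsmul_eq_mul]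
    rw [← ENNReal.ofReal_natCast, ← ENNReal.ofReal_mul (by positivity),
      ← ENNReal.ofReal_mul (by positivity)]
    congr 1
    field_simp
    ring

end Perturbation

end LatentMetricModel

/-- A non-integrable function has Bochner integral zero, so the bound needs no integrability and the
risk terms need no measurability check in the test variable. -/
lemma integral_le_of_lintegral_ofReal_le {α : Type*} [MeasurableSpace α] {ν : Measure α} {f : α → ℝ}
    (h0 : ∀ a, 0 ≤ f a) {c : ℝ} (hc : 0 ≤ c)
    (h : ∫⁻ a, ENNReal.ofReal (f a) ∂ν ≤ ENNReal.ofReal c) : ∫ a, f a ∂ν ≤ c := by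
  by_cases hf : Integrable f ν
  · rw [integral_eq_lintegral_of_nonneg_ae (ae_of_all _ h0) hf.aestronglyMeasurable]
    exact ENNReal.toReal_le_of_le_ofReal hc h
  · rw [integral_undef hf]
    exact hc

lemma integral_le_mul_of_lintegral_sum_sq_le {α : Type*} [MeasurableSpace α] {ν : Measure α}
    {n : ℕ} {f : α → ℝ} {q : Fin n → α → ℝ} {k D : ℝ} (h0 : ∀ a, 0 ≤ f a) (hk : 0 ≤ k)
    (hD : 0 ≤ D) (hf : ∀ᵐ a ∂ν, f a ≤ k * ∑ i, q i a ^ 2)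
    (h : ∫⁻ a, ∑ i, ENNReal.ofReal (q i a ^ 2) ∂ν ≤ ENNReal.ofReal D) :
    ∫ a, f a ∂ν ≤ k * D := by
  refine integral_le_of_lintegral_ofReal_le h0 (mul_nonneg hk hD) ?_
  calc _ ≤ ∫⁻ a, ENNReal.ofReal k * ∑ i, ENNReal.ofReal (q i a ^ 2) ∂ν := by
        refine lintegral_mono_ae ?_
        filter_upwards [hf] with a ha
        rw [← ENNReal.ofReal_sum_of_nonneg fun i _ => sq_nonneg _, ← ENNReal.ofReal_mul hk]
        exact ENNReal.ofReal_le_ofReal ha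
    _ ≤ _ := by
        rw [lintegral_const_mul' _ _ ENNReal.ofReal_ne_top, ENNReal.ofReal_mul hk]
        gcongr

namespace LatentMetricModel

variable {Ω Ξ 𝒵 : Type*} [MeasurableSpace Ω] [MeasurableSpace Ξ]
  [MetricSpace 𝒵] [CompactSpace 𝒵] [MeasurableSpace 𝒵] [BorelSpace 𝒵] {P : Measure Ω}
  [IsProbabilityMeasure P] {μ : Measure 𝒵} [IsProbabilityMeasure μ]
  {M : LatentMetricModel Ω Ξ 𝒵 P μ}

/-- The response noise enters a linear prediction only through the size of its weights. -/
lemma integral_sq_dotProduct_mulVec_y_le (M : LatentMetricModel Ω Ξ 𝒵 P μ) {n : ℕ}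
    {B : Matrix (Fin n) (Fin n) ℝ} {k : ℝ} (hB : ∀ q : Fin n → ℝ, ∑ i, (q ᵥ* B) i ^ 2 ≤
      k * ∑ i, q i ^ 2) {g : 𝒵 → ℝ} {G : ℝ} (hG : ∀ z, |g z| ^ 2 ≤ G) (ω : Ω) (q : Fin n → ℝ) :
    ∫ ω', |q ⬝ᵥ (B *ᵥ M.y n g ω ω')| ^ 2 ∂P ≤ k * (n * G + M.σy ^ 2) * ∑ i, q i ^ 2 := by
  set b := q ᵥ* B with hb
  have hne : Nonempty 𝒵 := nonempty_of_isProbabilityMeasure μ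
  have hG0 : 0 ≤ G := (sq_nonneg _).trans (hG hne.some)
  have h1 : ∀ ω', |q ⬝ᵥ (B *ᵥ M.y n g ω ω')| ^ 2 =
      (∑ i : Fin n, b i * g (M.z i ω) + ∑ i : Fin n, b i * M.ε i ω') ^ 2 := by
    intro ω'
    rw [Matrix.dotProduct_mulVec, sq_abs, ← hb, dotProduct, ← Finset.sum_add_distrib]
    simp only [y, mul_add]
  simp_rw [h1]
  rw [M.integral_sq_const_add_sum_eps]
  -- The regression values are not centered, so Cauchy-Schwarz over the sample costs a factor n; the
  -- independent noise does not.
  have h2 : (∑ i : Fin n, b i * g (M.z i ω)) ^ 2 ≤ (∑ i, b i ^ 2) * (n * G) := by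
    refine (Finset.sum_mul_sq_le_sq_mul_sq _ _ _).trans ?_
    refine mul_le_mul_of_nonneg_left ?_ (Finset.sum_nonneg fun i _ => sq_nonneg _)
    calc _ ≤ ∑ i : Fin n, G := Finset.sum_le_sum fun i _ => by
          have := hG (M.z i ω)
          rwa [sq_abs] at this
      _ = n * G := by simp
  calc _ ≤ (n * G + M.σy ^ 2) * ∑ i, b i ^ 2 := by linarith
    _ ≤ (n * G + M.σy ^ 2) * (k * ∑ i, q i ^ 2) :=
        mul_le_mul_of_nonneg_left (hB q) (by positivity)
    _ = _ := by ring

/-! ### The expansion at random points -/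

section Expansion

variable {p r : ℕ} {lam : Fin r → ℝ} {u : Fin r → 𝒵 → ℝ}

/-- The eigenvalue scalings of `W` and of the feature map cancel, so `W` sends features back to the
random functions, up to p^{-1/2}. -/
lemma W_mulVec_featureMap (M : LatentMetricModel Ω Ξ 𝒵 P μ) (hlam : ∀ l, 0 < lam l) {ω : Ω}
    {z : 𝒵} (j : Fin p)
    (h : M.psi j ω z = ∑ l, (∫ z', M.psi j ω z' * u l z' ∂μ) * u l z) :
    (M.W p lam u ω *ᵥ featureMap lam u z) j = (√(p : ℝ))⁻¹ * M.psi j ω z := by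
  rw [h, Matrix.mulVec, dotProduct, Finset.mul_sum]
  refine Finset.sum_congr rfl fun l _ => ?_
  have hl : √(lam l) ≠ 0 := (Real.sqrt_pos.2 (hlam l)).ne'
  simp only [W, featureMap, Matrix.of_apply, Real.sqrt_mul (hlam l).le, mul_inv]
  field_simp

/-- The exceptional null set of the expansion depends on the point. Fubini moves it past the test
point, and the independence of the latent sample from `ξ` moves it past the sample points. -/
lemma Regular.ae_ae_psi_eq_sum [μ.IsOpenPosMeasure] (hM : M.Regular) (hp : 1 ≤ p)
    (h : IsEigensystem μ (M.implicitKernel p) lam u) :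
    (∀ᵐ ω ∂P, ∀ᵐ z ∂μ, ∀ j : Fin p,
      M.psi j ω z = ∑ l, (∫ z', M.psi j ω z' * u l z' ∂μ) * u l z) ∧
    ∀ᵐ ω ∂P, ∀ i : ℕ, ∀ j : Fin p,
      M.psi j ω (M.z i ω) = ∑ l, (∫ z', M.psi j ω z' * u l z' ∂μ) * u l (M.z i ω) := by
  have hu := h.continuous (hM.continuous_implicitKernel p)
  have hKL := hM.ae_psi_eq_sum hp h
  constructor
  · refine (Measure.ae_ae_comm ?_).1 (ae_of_all μ hKL)
    have hm : ∀ j : Fin p, Measurable fun q : 𝒵 × Ω =>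
        ∑ l, (∫ z', M.psi j q.2 z' * u l z' ∂μ) * u l q.1 := fun j =>
      Finset.measurable_fun_sum _ fun l _ =>
        ((M.measurable_integral_psi_mul (P := P) j (hu l)).comp measurable_snd).mul
          ((hu l).measurable.comp measurable_fst)
    simp only [Set.ofPred_forall]
    exact MeasurableSet.iInter fun j => measurableSet_eq_fun
      ((M.measurable_uncurry_psi j).comp measurable_swap) (hm j)
  · rw [ae_all_iff]
    intro i
    -- A nonnegative functional whose vanishing is the expansion at the i-th sample point. By
    -- independence its mean can be computed with the latent points frozen, where it is zero.
    let F : (ℕ → 𝒵) × Ξ → ENNReal := fun q => ∑ j : Fin p, ENNReal.ofReal ((M.ψ j q.2 (q.1 i)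
      - ∑ l, (∫ z', M.ψ j q.2 z' * u l z' ∂μ) * u l (q.1 i)) ^ 2)
    have hFm : Measurable F := by
      refine Finset.measurable_fun_sum _ fun (j : Fin p) _ => Measurable.ennreal_ofReal
        (Measurable.pow_const (Measurable.sub ?_ ?_) 2)
      · exact M.measurable_uncurry_ψ_apply (h := fun f => f i) j (measurable_pi_apply i)
      · refine Finset.measurable_fun_sum _ fun l _ => Measurable.mul ?_ ?_
        · have h1 : StronglyMeasurable fun w : Ξ × 𝒵 => M.ψ j w.1 w.2 * u l w.2 :=
            ((M.measurable_ψ j).mul ((hu l).measurable.comp measurable_snd)).stronglyMeasurable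
          exact h1.integral_prod_right'.measurable.comp measurable_snd
        · exact (hu l).measurable.comp ((measurable_pi_apply i).comp measurable_fst)
    have h1 := IndepFun.lintegral_eq_lintegral_lintegral M.indep_z_ξ M.measurable_latent
      M.measurable_ξ hFm
    have h2 : ∀ ω, ∫⁻ ω', F ((fun i => M.z i ω), M.ξ ω') ∂P = 0 := by
      intro ω
      refine (lintegral_eq_zero_iff (hFm.comp (measurable_const.prodMk M.measurable_ξ))).2 ?_
      filter_upwards [hKL (M.z i ω)] with ω' hω'
      refine Finset.sum_eq_zero fun j _ => ?_
      rw [ENNReal.ofReal_eq_zero]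
      exact (pow_eq_zero_iff two_ne_zero |>.2 (sub_eq_zero.2 (hω' j))).le
    simp_rw [h2] at h1
    rw [lintegral_zero] at h1
    have h3 := (lintegral_eq_zero_iff (hFm.comp (M.measurable_latent.prodMk M.measurable_ξ))).1 h1
    filter_upwards [h3] with ω hω j
    have h4 := (Finset.sum_eq_zero_iff.1 hω) j (Finset.mem_univ j)
    rw [ENNReal.ofReal_eq_zero] at h4
    exact sub_eq_zero.1 (pow_eq_zero_iff two_ne_zero |>.1 (le_antisymm h4 (sq_nonneg _)))

end Expansion

/-! ### Mean sizes of the prediction weights -/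

section RiskMoments

/-- Total squared kernel deviation between a test point and the sample. -/
noncomputable def testDeviation (M : LatentMetricModel Ω Ξ 𝒵 P μ) (n p : ℕ) (ω : Ω) : ENNReal :=
  ∫⁻ zt, ∑ i : Fin n, ENNReal.ofReal (M.kernelDeviation p zt (M.z i ω) ω ^ 2) ∂μ

/-- Total squared correlation between the features of a test point and the covariate noise. -/
noncomputable def testCorrelation (M : LatentMetricModel Ω Ξ 𝒵 P μ) (n p : ℕ) (ω : Ω) : ENNReal :=
  ∫⁻ zt, ∑ i : Fin n, ENNReal.ofReal ((∑ j : Fin p, M.psi j ω zt * M.E i j ω) ^ 2) ∂μ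

/-- Squared Frobenius norm of the data matrix. -/
noncomputable def dataEnergy (M : LatentMetricModel Ω Ξ 𝒵 P μ) (n p : ℕ) (ω : Ω) : ENNReal :=
  ∑ i, ∑ j, ENNReal.ofReal (M.X n p ω i j ^ 2)

lemma Regular.measurable_testDeviation_integrand (hM : M.Regular) (n p : ℕ) :
    Measurable fun w : Ω × 𝒵 =>
      ∑ i : Fin n, ENNReal.ofReal (M.kernelDeviation p w.2 (M.z i w.1) w.1 ^ 2) := by
  refine Finset.measurable_fun_sum _ fun i _ => Measurable.ennreal_ofReal (Measurable.pow_const ?_ 2)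
  have h1 : ∀ j : Fin p, Measurable fun w : Ω × 𝒵 => M.psi j w.1 (M.z i w.1) := fun j =>
    (M.measurable_psi_random (h := fun f => f i) j (measurable_pi_apply (i : ℕ))).comp
      measurable_fst
  have h2 : Measurable fun w : Ω × 𝒵 => M.implicitKernel p w.2 (M.z i w.1) :=
    (hM.continuous_implicitKernel p).measurable.comp
      (measurable_snd.prodMk ((M.measurable_z i).comp measurable_fst))
  exact ((Finset.measurable_fun_sum _ fun (j : Fin p) _ =>
    (M.measurable_uncurry_psi j).mul (h1 j)).const_mul _).sub h2

lemma measurable_testCorrelation_integrand (M : LatentMetricModel Ω Ξ 𝒵 P μ) (n p : ℕ) :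
    Measurable fun w : Ω × 𝒵 => ∑ i : Fin n,
      ENNReal.ofReal ((∑ j : Fin p, M.psi j w.1 w.2 * M.E i j w.1) ^ 2) :=
  Finset.measurable_fun_sum _ fun i _ => ((Finset.measurable_fun_sum _ fun (j : Fin p) _ =>
    (M.measurable_uncurry_psi j).mul
      ((M.measurable_E i j).comp measurable_fst)).pow_const 2).ennreal_ofReal

lemma measurable_X_apply (M : LatentMetricModel Ω Ξ 𝒵 P μ) (n p : ℕ) (i : Fin n) (j : Fin p) :
    Measurable fun ω => M.X n p ω i j :=
  (M.measurable_psi_random (h := fun f => f i) j (measurable_pi_apply (i : ℕ))).add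
    ((M.measurable_E i j).const_mul _)

lemma Regular.measurable_testDeviation (hM : M.Regular) (n p : ℕ) :
    Measurable (M.testDeviation n p) :=
  (hM.measurable_testDeviation_integrand n p).lintegral_prod_right'

lemma measurable_testCorrelation (M : LatentMetricModel Ω Ξ 𝒵 P μ) (n p : ℕ) :
    Measurable (M.testCorrelation n p) :=
  (M.measurable_testCorrelation_integrand n p).lintegral_prod_right'

lemma measurable_dataEnergy (M : LatentMetricModel Ω Ξ 𝒵 P μ) (n p : ℕ) :
    Measurable (M.dataEnergy n p) :=
  Finset.measurable_fun_sum _ fun i _ => Finset.measurable_fun_sum _ fun j _ =>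
    ((M.measurable_X_apply n p i j).pow_const 2).ennreal_ofReal

lemma sum_const_ofReal (n : ℕ) {x : ℝ} :
    ∑ _i : Fin n, ENNReal.ofReal x = ENNReal.ofReal (n * x) := by
  rw [Finset.sum_const, Finset.card_univ, Fintype.card_fin, nsmul_eq_mul,
    ENNReal.ofReal_mul (Nat.cast_nonneg n), ENNReal.ofReal_natCast]

lemma Regular.lintegral_testDeviation_le (hM : M.Regular) (n : ℕ) {p : ℕ} (hp : 1 ≤ p) :
    ∫⁻ ω, M.testDeviation n p ω ∂P ≤ ENNReal.ofReal (n * (M.v₁ p / p)) := by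
  simp only [testDeviation]
  rw [lintegral_lintegral_swap (hM.measurable_testDeviation_integrand n p).aemeasurable]
  calc _ ≤ ∫⁻ _, ENNReal.ofReal (n * (M.v₁ p / p)) ∂μ := lintegral_mono fun zt => by
        rw [lintegral_finsetSum, ← sum_const_ofReal]
        · exact Finset.sum_le_sum fun i _ => hM.lintegral_sq_kernelDeviation_random_le
            (h := fun _ => zt) (h' := fun f => f i) hp measurable_const
            (measurable_pi_apply (i : ℕ))
        · intro i _
          have h1 : ∀ j : Fin p, Measurable fun ω => M.psi j ω (M.z i ω) := fun j =>
            M.measurable_psi_random (h := fun f => f i) j (measurable_pi_apply (i : ℕ))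
          have h2 : Measurable fun ω => M.implicitKernel p zt (M.z i ω) :=
            (hM.continuous_implicitKernel p).measurable.comp
              (measurable_const.prodMk (M.measurable_z i))
          exact ((((Finset.measurable_fun_sum _ fun (j : Fin p) _ =>
            (M.measurable_psi j zt).mul (h1 j)).const_mul _).sub h2).pow_const 2).ennreal_ofReal
    _ = _ := by simp

lemma Regular.lintegral_testCorrelation_le (hM : M.Regular) (n : ℕ) {p : ℕ} (hp : 1 ≤ p) :
    ∫⁻ ω, M.testCorrelation n p ω ∂P ≤ ENNReal.ofReal (n * (p * M.v₂ p)) := by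
  simp only [testCorrelation]
  rw [lintegral_lintegral_swap (M.measurable_testCorrelation_integrand n p).aemeasurable]
  calc _ ≤ ∫⁻ _, ENNReal.ofReal (n * (p * M.v₂ p)) ∂μ := lintegral_mono fun zt => by
        rw [lintegral_finsetSum, ← sum_const_ofReal]
        · exact Finset.sum_le_sum fun i _ => hM.lintegral_sq_sum_psi_noise_random_le
            (h := fun _ => zt) hp i measurable_const
        · intro i _
          exact ((Finset.measurable_fun_sum _ fun (j : Fin p) _ =>
            (M.measurable_psi j zt).mul (M.measurable_E i j)).pow_const 2).ennreal_ofReal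
    _ = _ := by simp

lemma Regular.lintegral_dataEnergy_le (hM : M.Regular) (n : ℕ) {p : ℕ} (hp : 1 ≤ p) :
    ∫⁻ ω, M.dataEnergy n p ω ∂P ≤ ENNReal.ofReal (n * (2 * p * (M.v₂ p + M.σx ^ 2))) := by
  have hv2 := M.v₂_nonneg p
  have hm := fun i j => ((M.measurable_X_apply n p i j).pow_const 2).ennreal_ofReal
  simp only [dataEnergy]
  rw [lintegral_finsetSum _ fun i _ => Finset.measurable_fun_sum _ fun j _ => hm i j,
    ← sum_const_ofReal]
  refine Finset.sum_le_sum fun i _ => ?_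
  have hψ : ∫⁻ ω, ENNReal.ofReal (∑ j : Fin p, M.psi j ω (M.z i ω) ^ 2) ∂P ≤
      ENNReal.ofReal (p * M.v₂ p) :=
    hM.lintegral_sum_sq_psi_random_le (h := fun f => f i) hp (measurable_pi_apply (i : ℕ))
  have hψm : Measurable fun ω => ∑ j : Fin p, M.psi j ω (M.z i ω) ^ 2 :=
    Finset.measurable_fun_sum _ fun (j : Fin p) _ =>
      (M.measurable_psi_random (h := fun f => f i) j (measurable_pi_apply (i : ℕ))).pow_const 2
  have hE : ∫⁻ ω, ENNReal.ofReal (∑ j : Fin p, M.E i j ω ^ 2) ∂P ≤ ENNReal.ofReal p := by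
    have hI : ∀ j : Fin p, Integrable (fun ω => M.E i j ω ^ 2) P := fun j =>
      (M.memLp_E i j).integrable_sq
    refine lintegral_ofReal_le_of_integral_le (integrable_finsetSum _ fun j _ => hI j)
      (fun ω => Finset.sum_nonneg fun j _ => sq_nonneg _) ?_
    rw [integral_finsetSum _ fun j _ => hI j]
    simp_rw [M.var_E]
    simp
  calc _ ≤ ∫⁻ ω, (ENNReal.ofReal 2 * ENNReal.ofReal (∑ j : Fin p, M.psi j ω (M.z i ω) ^ 2)
        + ENNReal.ofReal (2 * M.σx ^ 2) * ENNReal.ofReal (∑ j : Fin p, M.E i j ω ^ 2)) ∂P := by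
        refine lintegral_mono fun ω => ?_
        rw [← ENNReal.ofReal_sum_of_nonneg fun i _ => sq_nonneg _,
          ← ENNReal.ofReal_mul (by norm_num), ← ENNReal.ofReal_mul (by positivity),
          ← ENNReal.ofReal_add (by positivity) (by positivity), Finset.mul_sum, Finset.mul_sum,
          ← Finset.sum_add_distrib]
        refine ENNReal.ofReal_le_ofReal (Finset.sum_le_sum fun j _ => ?_)
        simp only [X, Matrix.of_apply]
        nlinarith [sq_nonneg (M.psi j ω (M.z i ω) - M.σx * M.E i j ω)]
    _ ≤ ENNReal.ofReal 2 * ENNReal.ofReal (p * M.v₂ p)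
        + ENNReal.ofReal (2 * M.σx ^ 2) * ENNReal.ofReal p := by
        rw [lintegral_add_left (by fun_prop), lintegral_const_mul' _ _ ENNReal.ofReal_ne_top,
          lintegral_const_mul' _ _ ENNReal.ofReal_ne_top]
        gcongr
    _ = _ := by
        rw [← ENNReal.ofReal_mul (by norm_num), ← ENNReal.ofReal_mul (by positivity),
          ← ENNReal.ofReal_add (by positivity) (by positivity)]
        congr 1
        ring

end RiskMoments

/-! ### Bounds for S₁, S₂ and S₃ given the sizes of the weights -/

section RiskBounds

variable {n p r : ℕ} {lam : Fin r → ℝ} {u : Fin r → 𝒵 → ℝ} {γ k G D : ℝ} {g : 𝒵 → ℝ} {ω : Ω}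

/-- Since Wφ = ψ/√p and ⟨φ(z), φ(z')⟩ is the kernel, the row φ(z_test)ᵀ(WᵀW − I)Φᵀ consists of the
kernel deviations between the test point and the sample. -/
lemma S₁_le (M : LatentMetricModel Ω Ξ 𝒵 P μ) (hk : 0 ≤ k) (hD : 0 ≤ D)
    (hlam : ∀ l, 0 < lam l)
    (hker : ∀ z z', M.implicitKernel p z z' = ∑ l, lam l * (u l z * u l z'))
    (hA : ∀ q : Fin n → ℝ, ∑ i, (q ᵥ* (M.A n p γ ω)⁻¹) i ^ 2 ≤ k * ∑ i, q i ^ 2)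
    (hG : ∀ z, |g z| ^ 2 ≤ G)
    (hz : ∀ i : ℕ, ∀ j : Fin p,
      M.psi j ω (M.z i ω) = ∑ l, (∫ z', M.psi j ω z' * u l z' ∂μ) * u l (M.z i ω))
    (hzt : ∀ᵐ z ∂μ, ∀ j : Fin p,
      M.psi j ω z = ∑ l, (∫ z', M.psi j ω z' * u l z' ∂μ) * u l z)
    (hdev : M.testDeviation n p ω ≤ ENNReal.ofReal D) :
    M.S₁ n p γ lam u g ω ≤ k * (n * G + M.σy ^ 2) * D := by
  have hne : Nonempty 𝒵 := nonempty_of_isProbabilityMeasure μ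
  have hG0 : 0 ≤ G := (sq_nonneg _).trans (hG hne.some)
  refine integral_le_mul_of_lintegral_sum_sq_le
    (q := fun (i : Fin n) zt => M.kernelDeviation p zt (M.z i ω) ω)
    (fun zt => integral_nonneg fun _ => by positivity) (by positivity) hD ?_ hdev
  filter_upwards [hzt] with zt hzt
  have hq : (featureMap lam u zt ᵥ* ((M.W p lam u ω)ᵀ * M.W p lam u ω - 1)) ᵥ*
      (M.Phi n lam u ω)ᵀ = fun i : Fin n => M.kernelDeviation p zt (M.z i ω) ω := by
    ext i
    have h2 : ∀ v : Fin r → ℝ, (v ᵥ* (M.Phi n lam u ω)ᵀ) i = v ⬝ᵥ featureMap lam u (M.z i ω) :=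
      fun v => rfl
    rw [h2, ← Matrix.dotProduct_mulVec, Matrix.sub_mulVec, Matrix.one_mulVec, dotProduct_sub,
      ← Matrix.mulVec_mulVec, Matrix.dotProduct_mulVec, Matrix.vecMul_transpose, kernelDeviation,
      hker]
    congr 1
    · rw [dotProduct, Finset.mul_sum]
      refine Finset.sum_congr rfl fun j _ => ?_
      rw [M.W_mulVec_featureMap hlam j (hzt j), M.W_mulVec_featureMap hlam j (hz i j)]
      have : (p : ℝ)⁻¹ = (√(p : ℝ))⁻¹ * (√(p : ℝ))⁻¹ := by
        rw [← mul_inv, Real.mul_self_sqrt (Nat.cast_nonneg p)]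
      rw [this]
      ring
    · refine Finset.sum_congr rfl fun l _ => ?_
      simp only [featureMap]
      rw [mul_mul_mul_comm, Real.mul_self_sqrt (hlam l).le]
  have h := M.integral_sq_dotProduct_mulVec_y_le hA hG ω
    ((featureMap lam u zt ᵥ* ((M.W p lam u ω)ᵀ * M.W p lam u ω - 1)) ᵥ* (M.Phi n lam u ω)ᵀ)
  simp only [thetaHat]
  simp_rw [Matrix.dotProduct_mulVec] at h ⊢
  rw [hq] at h ⊢
  exact h

/-- By Wφ = ψ/√p the weights are p^{-1/2}∑_j ψ_j(z_test)E_ij; squaring produces the extra 1/p. -/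
lemma S₂_le (M : LatentMetricModel Ω Ξ 𝒵 P μ) (hp : 1 ≤ p) (hk : 0 ≤ k) (hD : 0 ≤ D)
    (hlam : ∀ l, 0 < lam l)
    (hA : ∀ q : Fin n → ℝ, ∑ i, (q ᵥ* (M.A n p γ ω)⁻¹) i ^ 2 ≤ k * ∑ i, q i ^ 2)
    (hG : ∀ z, |g z| ^ 2 ≤ G)
    (hzt : ∀ᵐ z ∂μ, ∀ j : Fin p,
      M.psi j ω z = ∑ l, (∫ z', M.psi j ω z' * u l z' ∂μ) * u l z)
    (hcor : M.testCorrelation n p ω ≤ ENNReal.ofReal D) :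
    M.S₂ n p γ lam u g ω ≤ M.σx ^ 2 / p * (k * (n * G + M.σy ^ 2) * (p : ℝ)⁻¹ * D) := by
  have hne : Nonempty 𝒵 := nonempty_of_isProbabilityMeasure μ
  have hG0 : 0 ≤ G := (sq_nonneg _).trans (hG hne.some)
  refine mul_le_mul_of_nonneg_left ?_ (by positivity)
  refine integral_le_mul_of_lintegral_sum_sq_le
    (q := fun (i : Fin n) zt => ∑ j : Fin p, M.psi j ω zt * M.E i j ω)
    (fun zt => integral_nonneg fun _ => by positivity) (by positivity) hD ?_ hcor
  filter_upwards [hzt] with zt hzt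
  have hq : ∀ i, ((featureMap lam u zt ᵥ* (M.W p lam u ω)ᵀ) ᵥ* (M.noise n p ω)ᵀ) i
      = (√(p : ℝ))⁻¹ * ∑ j : Fin p, M.psi j ω zt * M.E i j ω := by
    intro i
    rw [Matrix.vecMul_transpose, Matrix.vecMul_transpose, Matrix.mulVec, dotProduct,
      Finset.mul_sum]
    refine Finset.sum_congr rfl fun j _ => ?_
    rw [M.W_mulVec_featureMap hlam j (hzt j)]
    simp only [noise, Matrix.of_apply]
    ring
  have h := M.integral_sq_dotProduct_mulVec_y_le hA hG ω
    ((featureMap lam u zt ᵥ* (M.W p lam u ω)ᵀ) ᵥ* (M.noise n p ω)ᵀ)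
  have e : ∑ i, ((featureMap lam u zt ᵥ* (M.W p lam u ω)ᵀ) ᵥ* (M.noise n p ω)ᵀ) i ^ 2
      = (p : ℝ)⁻¹ * ∑ i : Fin n, (∑ j : Fin p, M.psi j ω zt * M.E i j ω) ^ 2 := by
    simp_rw [hq, mul_pow]
    rw [← Finset.mul_sum, inv_pow, Real.sq_sqrt (Nat.cast_nonneg p)]
  rw [e, ← mul_assoc] at h
  simp_rw [Matrix.dotProduct_mulVec] at h ⊢
  exact h

/-- The weights are X e_test, and integrating out the orthonormal test noise leaves the squared
Frobenius norm of X. -/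
lemma S₃_le (M : LatentMetricModel Ω Ξ 𝒵 P μ) (hk : 0 ≤ k) (hD : 0 ≤ D)
    (hA : ∀ q : Fin n → ℝ, ∑ i, (q ᵥ* (M.A n p γ ω)⁻¹) i ^ 2 ≤ k * ∑ i, q i ^ 2)
    (hG : ∀ z, |g z| ^ 2 ≤ G) (hX : M.dataEnergy n p ω ≤ ENNReal.ofReal D) :
    M.S₃ n p γ g ω ≤ M.σx ^ 2 / (p : ℝ) ^ 2 * (k * (n * G + M.σy ^ 2) * D) := by
  have hne : Nonempty 𝒵 := nonempty_of_isProbabilityMeasure μ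
  have hG0 : 0 ≤ G := (sq_nonneg _).trans (hG hne.some)
  refine mul_le_mul_of_nonneg_left ?_ (by positivity)
  refine integral_le_mul_of_lintegral_sum_sq_le
    (q := fun (i : Fin n) ωt => ∑ j : Fin p, M.X n p ω i j * M.E 0 j ωt)
    (fun zt => integral_nonneg fun _ => by positivity) (by positivity) hD
    (ae_of_all _ fun ωt => ?_) ?_
  · have h := M.integral_sq_dotProduct_mulVec_y_le hA hG ω
      ((fun j : Fin p => M.E 0 j ωt) ᵥ* (M.X n p ω)ᵀ)
    simp_rw [Matrix.dotProduct_mulVec] at h ⊢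
    simp_rw [Matrix.vecMul_transpose] at h ⊢
    exact h
  · rw [lintegral_finsetSum]
    · simp_rw [M.lintegral_sq_sum_noise]
      refine le_trans (le_of_eq ?_) hX
      exact Finset.sum_congr rfl fun i _ => ENNReal.ofReal_sum_of_nonneg fun j _ => sq_nonneg _
    · intro i _
      exact ((Finset.measurable_fun_sum _ fun (j : Fin p) _ =>
        (M.measurable_E 0 j).const_mul _).pow_const 2).ennreal_ofReal

end RiskBounds

end LatentMetricModel

lemma diagNormSq_eq_sum {r : ℕ} (d v : Fin r → ℝ) : diagNormSq d v = ∑ l, d l * v l ^ 2 := by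
  rw [diagNormSq, dotProduct]
  refine Finset.sum_congr rfl fun l _ => ?_
  rw [Matrix.mulVec_diagonal]
  ring

/-- A sequence that is eventually bounded above is bounded above. -/
lemma exists_forall_le_of_isBigO_one {f : ℕ → ℝ} (hf : f =O[atTop] fun _ => (1 : ℝ)) :
    ∃ K, ∀ q, f q ≤ K := by
  obtain ⟨C, hC⟩ := hf.bound
  obtain ⟨q₀, hq₀⟩ := eventually_atTop.1 hC
  refine ⟨max C (∑ q ∈ Finset.range q₀, |f q|), fun q => ?_⟩
  rcases lt_or_ge q q₀ with hq | hq
  · exact le_max_of_le_right ((le_abs_self _).trans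
      (Finset.single_le_sum (f := fun q => |f q|) (fun _ _ => abs_nonneg _)
        (Finset.mem_range.2 hq)))
  · refine le_max_of_le_left ((le_abs_self _).trans ?_)
    simpa using hq₀ q hq

namespace LatentMetricModel

variable {Ω Ξ 𝒵 : Type*} [MeasurableSpace Ω] [MeasurableSpace Ξ]
  [MetricSpace 𝒵] [CompactSpace 𝒵] [MeasurableSpace 𝒵] [BorelSpace 𝒵] {P : Measure Ω}
  [IsProbabilityMeasure P] {μ : Measure 𝒵} [IsProbabilityMeasure μ]
  {M : LatentMetricModel Ω Ξ 𝒵 P μ}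

/-! ### Variance and bias as matrix expressions -/

section Deterministic

variable {n p r : ℕ} {lam : Fin r → ℝ} {u : Fin r → 𝒵 → ℝ} {γ : ℝ} {ω : Ω}

lemma transpose_A (M : LatentMetricModel Ω Ξ 𝒵 P μ) (n p : ℕ) (γ : ℝ) (ω : Ω) :
    (M.A n p γ ω)ᵀ = M.A n p γ ω := by
  simp [A, Matrix.transpose_add, Matrix.transpose_smul, Matrix.transpose_mul]

/-- Mercer's identity factors the kernel matrix; the noise variance and the ridge merge into one
regularization s = σx² + nγ. -/
lemma A_eq (M : LatentMetricModel Ω Ξ 𝒵 P μ)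
    (hker : ∀ z z', M.implicitKernel p z z' = ∑ l, lam l * (u l z * u l z')) :
    M.A n p γ ω = M.design n u ω * Matrix.diagonal lam * (M.design n u ω)ᵀ
      + (M.σx ^ 2 + n * γ) • (1 : Matrix (Fin n) (Fin n) ℝ) + M.perturbation n p ω := by
  have h : M.design n u ω * Matrix.diagonal lam * (M.design n u ω)ᵀ
      = Matrix.of (fun i i' : Fin n => M.implicitKernel p (M.z i ω) (M.z i' ω)) := by
    ext i i'
    rw [Matrix.mul_apply, Matrix.of_apply, hker]
    refine Finset.sum_congr rfl fun l _ => ?_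
    rw [Matrix.mul_diagonal, Matrix.transpose_apply, design, Matrix.of_apply, Matrix.of_apply]
    ring
  rw [h, A, perturbation, add_smul]
  abel

/-- Because Φ = UΛ^{1/2}, the Λ-norm of the estimator becomes the Euclidean norm of ΛUᵀA⁻¹w. -/
lemma sqrt_mul_thetaHat (M : LatentMetricModel Ω Ξ 𝒵 P μ) (hlam : ∀ l, 0 ≤ lam l)
    (w : Fin n → ℝ) (l : Fin r) :
    √(lam l) * M.thetaHat n p γ lam u ω w l =
      ((Matrix.diagonal lam * (M.design n u ω)ᵀ * (M.A n p γ ω)⁻¹) *ᵥ w) l := by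
  rw [thetaHat, ← Matrix.mulVec_mulVec, ← Matrix.mulVec_mulVec, Matrix.mulVec_diagonal,
    Matrix.mulVec, Matrix.mulVec, dotProduct, dotProduct, Finset.mul_sum, Finset.mul_sum]
  refine Finset.sum_congr rfl fun i _ => ?_
  simp only [Matrix.transpose_apply, Phi, design, Matrix.of_apply, featureMap]
  rw [← mul_assoc, ← mul_assoc, ← mul_assoc, Real.mul_self_sqrt (hlam l)]

lemma V_le (M : LatentMetricModel Ω Ξ 𝒵 P μ) (hlam : ∀ l, 0 ≤ lam l) {c : ℝ}
    (hM1 : ∀ l, ∑ i, ((M.A n p γ ω)⁻¹ * (M.design n u ω * Matrix.diagonal lam)) i l ^ 2 ≤ c) :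
    M.V n p γ lam u ω ≤ M.σy ^ 2 * (r * c) := by
  set M1 := (M.A n p γ ω)⁻¹ * (M.design n u ω * Matrix.diagonal lam) with hM1d
  have ht : Matrix.diagonal lam * (M.design n u ω)ᵀ * (M.A n p γ ω)⁻¹ = M1ᵀ := by
    rw [hM1d, Matrix.transpose_mul, Matrix.transpose_mul, Matrix.transpose_nonsing_inv,
      M.transpose_A, Matrix.diagonal_transpose]
  have hpt : ∀ ω', diagNormSq lam (M.thetaHat n p γ lam u ω (M.eps n ω')) =
      ∑ l, (0 + ∑ i : Fin n, M1 i l * M.ε i ω') ^ 2 := by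
    intro ω'
    rw [diagNormSq_eq_sum]
    refine Finset.sum_congr rfl fun l _ => ?_
    rw [← Real.sq_sqrt (hlam l), ← mul_pow, M.sqrt_mul_thetaHat hlam, ht, zero_add]
    rfl
  simp only [V]
  simp_rw [hpt]
  rw [integral_finsetSum _ fun l _ => integrable_sq_const_add_sum
    (f := fun i : Fin n => M.ε i) (fun i => M.memLp_ε i) 0 fun i => M1 i l]
  simp_rw [M.integral_sq_const_add_sum_eps]
  calc _ ≤ ∑ _l : Fin r, M.σy ^ 2 * c := Finset.sum_le_sum fun l _ => by
        have := mul_le_mul_of_nonneg_left (hM1 l) (sq_nonneg M.σy)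
        linarith
    _ = _ := by
        simp only [Finset.sum_const, Finset.card_univ, Fintype.card_fin, nsmul_eq_mul]
        ring

/-- In the variable x = Λ^{-1/2}θ one has Φθ = UΛx and Λ^{1/2}θ = Λx, so the bias is the smoother
error applied to x, and ‖x‖² is the Λ⁻¹-norm of θ. -/
lemma B_le (M : LatentMetricModel Ω Ξ 𝒵 P μ) (hlam : ∀ l, 0 < lam l) (θ : Fin r → ℝ) {c : ℝ}
    (hb : ∀ x : Fin r → ℝ, ∑ l, ((Matrix.diagonal lam * (M.design n u ω)ᵀ * (M.A n p γ ω)⁻¹ *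
      (M.design n u ω * Matrix.diagonal lam) - Matrix.diagonal lam) *ᵥ x) l ^ 2 ≤
        c * ∑ l, x l ^ 2) :
    M.B n p γ lam u θ ω ≤ c * diagNormSq (fun l => (lam l)⁻¹) θ := by
  set x : Fin r → ℝ := fun l => (√(lam l))⁻¹ * θ l with hx
  have hs : ∀ l, √(lam l) ≠ 0 := fun l => (Real.sqrt_pos.2 (hlam l)).ne'
  have hxs : ∑ l, x l ^ 2 = diagNormSq (fun l => (lam l)⁻¹) θ := by
    rw [diagNormSq_eq_sum]
    refine Finset.sum_congr rfl fun l _ => ?_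
    rw [hx, mul_pow, inv_pow, Real.sq_sqrt (hlam l).le]
  have hlx : ∀ l, lam l * x l = √(lam l) * θ l := by
    intro l
    rw [hx, ← Real.mul_self_sqrt (hlam l).le]
    simp only [Real.sqrt_mul_self (Real.sqrt_nonneg _)]
    field_simp [hs l]
  have hΦ : M.Phi n lam u ω *ᵥ θ = (M.design n u ω * Matrix.diagonal lam) *ᵥ x := by
    ext i
    rw [← Matrix.mulVec_mulVec, Matrix.mulVec, Matrix.mulVec, dotProduct, dotProduct]
    refine Finset.sum_congr rfl fun l _ => ?_
    rw [Matrix.mulVec_diagonal, hlx]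
    simp only [Phi, design, Matrix.of_apply, featureMap]
    ring
  rw [← hxs]
  refine le_trans (le_of_eq ?_) (hb x)
  rw [B, diagNormSq_eq_sum]
  refine Finset.sum_congr rfl fun l _ => ?_
  conv_lhs => rw [← Real.sq_sqrt (hlam l).le, ← mul_pow, Pi.sub_apply, mul_sub,
    M.sqrt_mul_thetaHat (fun l => (hlam l).le), hΦ, Matrix.mulVec_mulVec, ← hlx]
  rw [Matrix.sub_mulVec, Pi.sub_apply, Matrix.mulVec_diagonal]

end Deterministic

/-- The risk bounds for fixed sample size and dimension, with explicit constants. -/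
theorem Regular.risk_bounds [μ.IsOpenPosMeasure] (hM : M.Regular) {n p r : ℕ} (hn : 1 ≤ n)
    (hp : 1 ≤ p) {lam : Fin r → ℝ} {u : Fin r → 𝒵 → ℝ}
    (h : IsEigensystem μ (M.implicitKernel p) lam u) {R : ℝ} (hR : ∀ z, ∑ l, u l z ^ 2 ≤ R)
    {g : 𝒵 → ℝ} {θ : Fin r → ℝ} (hg : ∀ z, g z = featureMap lam u z ⬝ᵥ θ) {γ : ℝ}
    (hs : 0 < M.σx ^ 2 + n * γ) {δ : ℝ} (hδ : 0 < δ) :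
    1 - δ - 2 * r ^ 2 * Real.exp (-((n : ℝ) / (8 * r ^ 2 * R ^ 2)))
        - 32 * ((n : ℝ) ^ 2 / p *
          ((M.v₁ p + M.σx ^ 2 * M.v₂ p + M.σx ^ 4 * M.v₃) / (M.σx ^ 2 + n * γ) ^ 2))
      ≤ P.real {ω | IsUnit (M.A n p γ ω) ∧
        M.V n p γ lam u ω ≤ 144 * (M.σy ^ 2 * r / n) ∧
        M.B n p γ lam u θ ω ≤ 144 * (diagNormSq (fun l => (lam l)⁻¹) θ / (n : ℝ) ^ 2 *
          (M.σx ^ 2 + n * γ) ^ 2) ∧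
        M.S₁ n p γ lam u g ω + M.S₂ n p γ lam u g ω + M.S₃ n p γ g ω ≤
          144 * ((n : ℝ) ^ 2 / (δ * p) * ((M.v₁ p + M.σx ^ 2 * M.v₂ p + M.σx ^ 4) *
            ((⨆ z, |g z| ^ 2) + M.σy ^ 2 / n) / (M.σx ^ 2 + n * γ) ^ 2))} := by
  set s := M.σx ^ 2 + n * γ with hsd
  have hn0 : (0 : ℝ) < n := by exact_mod_cast hn
  have hp0 : (0 : ℝ) < p := by exact_mod_cast hp
  have hv1 := M.v₁_nonneg p
  have hv2 := M.v₂_nonneg p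
  have hu := h.continuous (hM.continuous_implicitKernel p)
  have hker := h.kernel_eq_sum (hM.continuous_implicitKernel p)
  have hlam0 : ∀ l, 0 ≤ lam l := fun l => (h.pos l).le
  obtain ⟨hKL1, hKL2⟩ := hM.ae_ae_psi_eq_sum hp h
  set G := ⨆ z, |g z| ^ 2 with hGd
  have hG : ∀ z, |g z| ^ 2 ≤ G := by
    have hgc : Continuous g := by
      rw [show g = fun z => featureMap lam u z ⬝ᵥ θ from funext hg]
      simp only [featureMap, dotProduct]
      fun_prop
    obtain ⟨C, hC⟩ := exists_forall_abs_le_of_continuous (hgc.abs.pow 2)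
    exact fun z => le_ciSup (f := fun z => |g z| ^ 2)
      ⟨C, by rintro _ ⟨w, rfl⟩; exact (le_abs_self _).trans (hC w)⟩ z
  have hG0 : 0 ≤ G := Real.iSup_nonneg fun _ => by positivity
  set good := {ω | IsUnit (M.A n p γ ω) ∧
        M.V n p γ lam u ω ≤ 144 * (M.σy ^ 2 * r / n) ∧
        M.B n p γ lam u θ ω ≤ 144 * (diagNormSq (fun l => (lam l)⁻¹) θ / (n : ℝ) ^ 2 * s ^ 2) ∧
        M.S₁ n p γ lam u g ω + M.S₂ n p γ lam u g ω + M.S₃ n p γ g ω ≤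
          144 * ((n : ℝ) ^ 2 / (δ * p) * ((M.v₁ p + M.σx ^ 2 * M.v₂ p + M.σx ^ 4) *
            (G + M.σy ^ 2 / n) / s ^ 2))} with hgood
  -- Each threshold is 3/δ times the bound on the mean, so that Markov's inequality yields
  -- probability δ/3.
  set D₁ := 3 / δ * (n * (M.v₁ p / p)) with hD1
  set D₂ := 3 / δ * (n * (p * M.v₂ p)) with hD2
  set D₃ := 3 / δ * (n * (2 * p * (M.v₂ p + M.σx ^ 2))) with hD3
  set b₁ := {ω | (s / 2) ^ 2 < ∑ i, ∑ i', M.perturbation n p ω i i' ^ 2} with hb1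
  set b₂ := {ω | ((n : ℝ) / 2) ^ 2 < ∑ l, ∑ m, ((M.design n u ω)ᵀ * M.design n u ω -
        (n : ℝ) • (1 : Matrix (Fin r) (Fin r) ℝ)) l m ^ 2} with hb2
  set b₃ := {ω | ENNReal.ofReal D₁ < M.testDeviation n p ω} with hb3
  set b₄ := {ω | ENNReal.ofReal D₂ < M.testCorrelation n p ω} with hb4
  set b₅ := {ω | ENNReal.ofReal D₃ < M.dataEnergy n p ω} with hb5
  set N := {ω | ¬ ((∀ᵐ z ∂μ, ∀ j : Fin p,
      M.psi j ω z = ∑ l, (∫ z', M.psi j ω z' * u l z' ∂μ) * u l z) ∧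
    ∀ i : ℕ, ∀ j : Fin p,
      M.psi j ω (M.z i ω) = ∑ l, (∫ z', M.psi j ω z' * u l z' ∂μ) * u l (M.z i ω))} with hN
  have hN0 : P.real N = 0 := by
    rw [measureReal_def, ae_iff.1 (hKL1.and hKL2), ENNReal.toReal_zero]
  have hP1 : P.real b₁ ≤ _ := hM.measure_perturbation_le n hp hs
  have hP2 : P.real b₂ ≤ _ := M.measure_gram_deviation_le hu h.orthonormal hR n
  have hthird : ∀ x : ℝ, δ / 3 * (3 / δ * x) = x := fun x => by field_simp
  have hP3 : P.real b₃ ≤ δ / 3 := measure_lt_le_of_lintegral_le (hM.measurable_testDeviation n p)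
    (by positivity) (by rw [hD1, hthird]; exact hM.lintegral_testDeviation_le n hp)
  have hP4 : P.real b₄ ≤ δ / 3 := measure_lt_le_of_lintegral_le (M.measurable_testCorrelation n p)
    (by positivity) (by rw [hD2, hthird]; exact hM.lintegral_testCorrelation_le n hp)
  have hP5 : P.real b₅ ≤ δ / 3 := measure_lt_le_of_lintegral_le (M.measurable_dataEnergy n p)
    (by positivity) (by rw [hD3, hthird]; exact hM.lintegral_dataEnergy_le n hp)
  -- The good event and the bad ones cover Ω, so subadditivity suffices and measurability of the
  -- good event is not needed.
  have hcover : (Set.univ : Set Ω) ⊆ good ∪ (b₁ ∪ (b₂ ∪ (b₃ ∪ (b₄ ∪ (b₅ ∪ N))))) := by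
    intro ω _
    by_cases h1 : ω ∈ b₁
    · simp [h1]
    by_cases h2 : ω ∈ b₂
    · simp [h2]
    by_cases h3 : ω ∈ b₃
    · simp [h3]
    by_cases h4 : ω ∈ b₄
    · simp [h4]
    by_cases h5 : ω ∈ b₅
    · simp [h5]
    by_cases h6 : ω ∈ N
    · simp [h6]
    refine Or.inl ?_
    rw [hb1, Set.mem_ofPred_eq, not_lt] at h1
    rw [hb2, Set.mem_ofPred_eq, not_lt] at h2
    rw [hb3, Set.mem_ofPred_eq, not_lt] at h3
    rw [hb4, Set.mem_ofPred_eq, not_lt] at h4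
    rw [hb5, Set.mem_ofPred_eq, not_lt] at h5
    rw [hN, Set.mem_ofPred_eq, not_not] at h6
    obtain ⟨hAu, hAi, hrest⟩ := ridge_bounds hlam0 hs (M.A_eq (γ := γ) hker)
      (M.transpose_A n p γ ω) h1
    obtain ⟨hV, hB⟩ := hrest hn h2
    have hk : (0 : ℝ) ≤ 4 / s ^ 2 := by positivity
    have hS1 := M.S₁_le hk (by positivity) h.pos hker hAi hG h6.2 h6.1 h3
    have hS2 := M.S₂_le hp hk (by positivity) h.pos hAi hG h6.1 h4
    have hS3 := M.S₃_le hk (by positivity) hAi hG h5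
    refine ⟨hAu, (M.V_le hlam0 hV).trans ?_, (M.B_le h.pos θ hB).trans ?_,
      (add_le_add (add_le_add hS1 hS2) hS3).trans ?_⟩
    · have : M.σy ^ 2 * (r * (32 / n)) = 32 * (M.σy ^ 2 * r / n) := by ring
      rw [this]
      gcongr
      norm_num
    -- The bias is what fixes the constant: 144 = 12².
    · refine le_of_eq ?_
      field_simp
      ring
    -- With 4/s² and 3/δ, the S₁ term gives 12v₁, the S₂ term 12σx²v₂, and the S₃ term 24σx²v₂ +
    -- 24σx⁴, the 2 coming from splitting X into signal and noise.
    · have e : 4 / s ^ 2 * (n * G + M.σy ^ 2) * D₁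
          + M.σx ^ 2 / p * (4 / s ^ 2 * (n * G + M.σy ^ 2) * (p : ℝ)⁻¹ * D₂)
          + M.σx ^ 2 / (p : ℝ) ^ 2 * (4 / s ^ 2 * (n * G + M.σy ^ 2) * D₃)
          = (n : ℝ) ^ 2 / (δ * p) * ((12 * M.v₁ p + 36 * (M.σx ^ 2 * M.v₂ p) + 24 * M.σx ^ 4) *
            (G + M.σy ^ 2 / n) / s ^ 2) := by
        rw [hD1, hD2, hD3]
        field_simp
        ring
      have e' : 144 * ((n : ℝ) ^ 2 / (δ * p) * ((M.v₁ p + M.σx ^ 2 * M.v₂ p + M.σx ^ 4) *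
            (G + M.σy ^ 2 / n) / s ^ 2)) = (n : ℝ) ^ 2 / (δ * p) *
            ((144 * (M.v₁ p + M.σx ^ 2 * M.v₂ p + M.σx ^ 4)) * (G + M.σy ^ 2 / n) / s ^ 2) := by
        ring
      rw [e, e']
      gcongr
      have : 0 ≤ M.σx ^ 2 * M.v₂ p := by positivity
      have : 0 ≤ M.σx ^ 4 := by positivity
      linarith
  have htot : 1 ≤ P.real good + (P.real b₁ + (P.real b₂ + (P.real b₃ + (P.real b₄ +
      (P.real b₅ + P.real N))))) := by
    calc (1 : ℝ) = P.real Set.univ := by simp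
      _ ≤ _ := measureReal_mono hcover
      _ ≤ _ := by
        refine (measureReal_union_le _ _).trans ?_
        gcongr
        refine (measureReal_union_le _ _).trans ?_
        gcongr
        refine (measureReal_union_le _ _).trans ?_
        gcongr
        refine (measureReal_union_le _ _).trans ?_
        gcongr
        refine (measureReal_union_le _ _).trans ?_
        gcongr
        exact measureReal_union_le _ _
  linarith

end LatentMetricModel

/-- A fixed prefactor of an exponentially small term is absorbed by a smaller exponent. -/
lemma mul_exp_neg_le_exp_half {a c x : ℝ} (hx : 2 * a ≤ c * x) :
    a * Real.exp (-(c * x)) ≤ Real.exp (-(c / 2 * x)) := by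
  have h1 : a ≤ Real.exp (c / 2 * x) := by
    have := Real.add_one_le_exp (c / 2 * x)
    linarith
  have h2 : Real.exp (-(c / 2 * x)) = Real.exp (c / 2 * x) * Real.exp (-(c * x)) := by
    rw [← Real.exp_add]
    congr 1
    ring
  rw [h2]
  gcongr

theorem theorem4 {Ω Ξ 𝒵 : Type*} [MeasurableSpace Ω] [MeasurableSpace Ξ]
    [MetricSpace 𝒵] [CompactSpace 𝒵] [MeasurableSpace 𝒵] [BorelSpace 𝒵]
    (P : Measure Ω) [IsProbabilityMeasure P]
    (μ : Measure 𝒵) [IsProbabilityMeasure μ] [μ.IsOpenPosMeasure]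
    (M : LatentMetricModel Ω Ξ 𝒵 P μ) (hM : M.Regular)
    -- spectral data of the implicit kernel for each dimension `p`, and its finite rank `kmax p`
    (kmax : ℕ → ℕ) (lam : (p : ℕ) → Fin (kmax p) → ℝ) (u : (p : ℕ) → Fin (kmax p) → 𝒵 → ℝ)
    (hsys : ∀ p, 1 ≤ p → IsEigensystem μ (M.implicitKernel p) (lam p) (u p))
    -- the regression function (which may vary with `p`) and its coefficients
    (g : ℕ → 𝒵 → ℝ) (θ : (p : ℕ) → Fin (kmax p) → ℝ)
    (hg : ∀ p, 1 ≤ p → ∀ z, g p z = featureMap (lam p) (u p) z ⬝ᵥ θ p)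
    -- boundedness of the rank and of the coefficients `β` as `p → ∞`
    (hkmax : (fun p => (kmax p : ℝ)) =O[atTop] fun _ => (1 : ℝ))
    (hβ : (fun p => supBeta (lam p) (u p)) =O[atTop] fun _ => (1 : ℝ))
    -- the dimension and the ridge parameter as functions of the sample size
    (p : ℕ → ℕ) (hp : Monotone p) (hp1 : ∀ n, 1 ≤ p n)
    (γ : ℕ → ℝ) (hγ : Antitone γ) (hγ0 : ∀ n, 0 ≤ γ n)
    (hreg : ∀ n, 0 < max M.σx (γ n)) :
    ∃ C₁ C₂ c : ℝ, 0 < c ∧ ∃ N : ℕ, ∀ n, N ≤ n → ∀ δ : ℝ, 0 < δ →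
      1 - δ - Real.exp (-(c * ((n : ℝ) / max 1 (kmax (p n) : ℝ))))
          - C₂ * ((n : ℝ) ^ 2 / p n *
            ((M.v₁ (p n) + M.σx ^ 2 * M.v₂ (p n) + M.σx ^ 4 * M.v₃) /
              (M.σx ^ 2 + n * γ n) ^ 2))
        ≤ P.real {ω |
          IsUnit (M.A n (p n) (γ n) ω) ∧
          M.V n (p n) (γ n) (lam (p n)) (u (p n)) ω ≤ C₁ * (M.σy ^ 2 * kmax (p n) / n) ∧
          M.B n (p n) (γ n) (lam (p n)) (u (p n)) (θ (p n)) ω ≤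
            C₁ * (diagNormSq (fun l => (lam (p n) l)⁻¹) (θ (p n)) / (n : ℝ) ^ 2 *
              (M.σx ^ 2 + n * γ n) ^ 2) ∧
          M.S₁ n (p n) (γ n) (lam (p n)) (u (p n)) (g (p n)) ω +
              M.S₂ n (p n) (γ n) (lam (p n)) (u (p n)) (g (p n)) ω +
              M.S₃ n (p n) (γ n) (g (p n)) ω ≤
            C₁ * ((n : ℝ) ^ 2 / (δ * p n) *
              ((M.v₁ (p n) + M.σx ^ 2 * M.v₂ (p n) + M.σx ^ 4) *
                ((⨆ z, |g (p n) z| ^ 2) + M.σy ^ 2 / n) / (M.σx ^ 2 + n * γ n) ^ 2))} := by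
  obtain ⟨K₁, hK₁⟩ := exists_forall_le_of_isBigO_one hkmax
  obtain ⟨K₂, hK₂⟩ := exists_forall_le_of_isBigO_one hβ
  -- One bound for rank and β at all dimensions, so the constants below do not depend on n or δ. The
  -- squares of the eigenfunctions then sum to at most K·K.
  set K := max 1 (max K₁ K₂) with hK
  have hK1 : 1 ≤ K := le_max_left _ _
  have hr : ∀ q, (kmax q : ℝ) ≤ K := fun q =>
    (hK₁ q).trans ((le_max_left _ _).trans (le_max_right _ _))
  have hb : ∀ q, supBeta (lam q) (u q) ≤ K := fun q =>
    (hK₂ q).trans ((le_max_right _ _).trans (le_max_right _ _))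
  set R := K * K with hR
  have hR0 : 0 < R := by positivity
  set c := 1 / (8 * K ^ 2 * R ^ 2) with hc
  have hc0 : 0 < c := by positivity
  -- From here on cn ≥ 4K², which lets half of the exponent absorb the union bound prefactor 2K².
  obtain ⟨N, hN⟩ := exists_nat_ge (4 * K ^ 2 / c)
  refine ⟨144, 32, c / 2, by positivity, max 1 N, fun n hn δ hδ => ?_⟩
  have hn1 : 1 ≤ n := (le_max_left _ _).trans hn
  have hn0 : (0 : ℝ) < n := by exact_mod_cast hn1
  have hnN : 4 * K ^ 2 / c ≤ n := hN.trans (by exact_mod_cast (le_max_right _ _).trans hn)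
  have hs : 0 < M.σx ^ 2 + n * γ n := by
    rcases lt_max_iff.1 (hreg n) with h | h
    · have := mul_nonneg hn0.le (hγ0 n)
      positivity
    · have := mul_pos hn0 h
      positivity
  have hsysn := hsys (p n) (hp1 n)
  have hu := hsysn.continuous (hM.continuous_implicitKernel (p n))
  have hbd : ∀ z, ∑ l, u (p n) l z ^ 2 ≤ R := fun z =>
    (hsysn.sum_sq_le_supBeta_mul hu z).trans
      (mul_le_mul (hb _) (hr _) (Nat.cast_nonneg _) (by positivity))
  have hexp : 2 * (kmax (p n) : ℝ) ^ 2 *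
      Real.exp (-((n : ℝ) / (8 * (kmax (p n) : ℝ) ^ 2 * R ^ 2))) ≤
      Real.exp (-(c / 2 * ((n : ℝ) / max 1 (kmax (p n) : ℝ)))) := by
    -- For rank zero the prefactor vanishes; the exponent, a division by zero, is then irrelevant.
    rcases Nat.eq_zero_or_pos (kmax (p n)) with h0 | h0
    · rw [h0]
      simp only [Nat.cast_zero, ne_eq, OfNat.ofNat_ne_zero, not_false_eq_true, zero_pow, mul_zero,
        zero_mul]
      positivity
    · have h0' : (0 : ℝ) < kmax (p n) := by exact_mod_cast h0
      have e1 : c * n ≤ (n : ℝ) / (8 * (kmax (p n) : ℝ) ^ 2 * R ^ 2) := by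
        rw [hc, one_div, inv_mul_eq_div]
        gcongr
        exact hr _
      -- Dividing by max(1, rank) only weakens the exponent, since the dependence on the rank is
      -- already absorbed in c.
      have e2 : (n : ℝ) / max 1 (kmax (p n) : ℝ) ≤ n := div_le_self hn0.le (le_max_left _ _)
      calc _ ≤ 2 * K ^ 2 * Real.exp (-(c * n)) := by
            gcongr
            exact hr _
        _ ≤ Real.exp (-(c / 2 * n)) := by
            refine mul_exp_neg_le_exp_half ?_
            rw [div_le_iff₀ hc0] at hnN
            linarith
        _ ≤ _ := by gcongr
  refine le_trans ?_ (hM.risk_bounds hn1 (hp1 n) hsysn hbd (hg (p n) (hp1 n)) hs hδ)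
  linarith
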